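/- Let $\mathrm{Sh}$ be the Shrikhande graph, i.e. the graph on $\mathbb{Z}_4^2$ in which two vertices are adjacent if and only if their difference is one of $\pm(1,0)$, $\pm(0,1)$, $\pm(1,1)$. For integers $m,n\ge 0$ let $D(m,n)=\mathrm{Sh}^m\times K_4^n$ be the Cartesian product of $m$ copies of $\mathrm{Sh}$ and $n$ copies of the complete graph $K_4$ (a Doob graph if $m>0$, the Hamming graph $H(n,4)$ if $m=0$). Then the number of maximum independent sets (distance-$2$ MDS codes), that is, of independent sets of largest cardinality, in $D(m,n)$ is $$2^{2^{2m+n-1}(1+o(1))}\qquad\text{as } 2m+n\to\infty,$$ i.e. it equals $2^{2^{2m+n-1}(1+\varepsilon(m,n))}$ with real numbers $\varepsilon(m,n)$ such that for every $\delta>0$ there is an $N$ with $|\varepsilon(m,n)|<\delta$ for all $m,n\ge 0$ with $2m+n\ge N$. -/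

import Mathlib

namespace DoobGraph

/-- The Shrikhande graph: the Cayley graph on `ℤ₄ × ℤ₄` with connection set
`{±(1,0), ±(0,1), ±(1,1)}`; the negatives are supplied by `circulantGraph`. -/
def shrikhande : SimpleGraph (ZMod 4 × ZMod 4) :=
  SimpleGraph.circulantGraph {(1, 0), (0, 1), (1, 1)}

/-- The Cartesian power of `k` copies of `G`: two tuples are adjacent when they are adjacent in
exactly one coordinate and agree in all the others. -/
def cartesianPower {V : Type*} (G : SimpleGraph V) (k : ℕ) : SimpleGraph (Fin k → V) where
  Adj x y := ∃ i, G.Adj (x i) (y i) ∧ ∀ j, j ≠ i → x j = y j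
  symm := ⟨fun _ _ ⟨i, h, h'⟩ => ⟨i, h.symm, fun j hj => (h' j hj).symm⟩⟩
  loopless := ⟨fun _ ⟨_, h, _⟩ => h.ne rfl⟩

/-- The graph `D(m, n)`, the Cartesian product of `m` copies of the Shrikhande graph and `n`
copies of the complete graph `K₄`. -/
def doob (m n : ℕ) : SimpleGraph ((Fin m → ZMod 4 × ZMod 4) × (Fin n → Fin 4)) :=
  (cartesianPower shrikhande m).boxProd (cartesianPower (⊤ : SimpleGraph (Fin 4)) n)

/-- The number of maximum independent sets (independent sets of largest cardinality) of
`D(m, n)`. -/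
noncomputable def numMDS (m n : ℕ) : ℕ :=
  {S : Finset ((Fin m → ZMod 4 × ZMod 4) × (Fin n → Fin 4)) |
    (doob m n).IsMaximumIndepSet S}.ncard

end DoobGraph

/-!
A maximum independent set of `D(m, n)` contains exactly a quarter of the vertices.

*Lower bound.* Cut each Shrikhande factor into four 4-cycles and each `K₄` into two edges. The
products of these blocks have a proper 2-colouring, and blocks with the same total parity are not
joined by edges, so a colour class may be chosen freely in each of the `2 ^ (2m + n - 1)` blocks of
one parity.

*Upper bound.* The sixteen maximum independent sets of `Sh` embed into those of `K₄ □ K₄` with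
disjointness preserved, hence replacing a Shrikhande factor by two complete factors does not
decrease the number of maximum independent sets, and it suffices to bound the number of MDS codes
in the Hamming graph `H(N, 4)`.

By a Linial–Luria type bound, the number of codes inside a set times the number of codes inside its
complement is bounded. Call a code splittable if its last two layers contain a small union of
connected components of their common graph. Splittable codes are few: a component determines the
union of the last two layers, and then the bound limits the choices for all layers. A code that is
not splittable is recovered at little cost from its first two layers, and iterating this `d` times,
from its `2 ^ d` leaves. The leaves form a homomorphism from the `d`-cube to the disjointness graph
of the codes of length `N - d`, and again the bound makes these homomorphisms few. If the logarithm
of the number of codes is eventually at most `(1 + t) * 2 ^ (N - 1)`, weighing the two possibilities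
against each other gives the same bound with `t / (1 + t) + δ` in place of `t`, for every `δ > 0`.
The infimum `t` of the admissible constants thus satisfies `t ≤ t / (1 + t)`, so it is zero.
-/

namespace DoobGraph

open Finset

section Lines

variable {α : Type*} [Fintype α] [DecidableEq α] {n : ℕ}

/-- The trace of `M` on the line through `x` in direction `i`, as a set of letters. -/
def lineTrace (M : Finset (Fin n → α)) (i : Fin n) (x : Fin n → α) : Finset α :=
  {a | Function.update x i a ∈ M}

/-- The sets of words that meet every line in a number of points satisfying `p`. -/
def LineCard (p : ℕ → Prop) (M : Finset (Fin n → α)) : Prop :=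
  ∀ i x, p #(lineTrace M i x)

instance (p : ℕ → Prop) [DecidablePred p] (M : Finset (Fin n → α)) : Decidable (LineCard p M) :=
  inferInstanceAs (Decidable (∀ i x, p #(lineTrace M i x)))

/-- The set of words that `M` contains after the first letter `a`. -/
def layer (M : Finset (Fin (n + 1) → α)) (a : α) : Finset (Fin n → α) :=
  {x | Fin.cons a x ∈ M}

/-- The set of first letters with which the word `x` extends to an element of `M`. -/
def fiber (M : Finset (Fin (n + 1) → α)) (x : Fin n → α) : Finset α :=
  {a | Fin.cons a x ∈ M}

theorem mem_lineTrace {M : Finset (Fin n → α)} {i : Fin n} {x : Fin n → α} {a : α} :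
    a ∈ lineTrace M i x ↔ Function.update x i a ∈ M := by
  simp [lineTrace]

theorem mem_layer {M : Finset (Fin (n + 1) → α)} {a : α} {x : Fin n → α} :
    x ∈ layer M a ↔ Fin.cons a x ∈ M := by
  simp [layer]

theorem mem_fiber {M : Finset (Fin (n + 1) → α)} {x : Fin n → α} {a : α} :
    a ∈ fiber M x ↔ x ∈ layer M a := by
  simp [fiber, layer]

theorem layer_bijective :
    Function.Bijective (layer : Finset (Fin (n + 1) → α) → α → Finset (Fin n → α)) := by
  refine ⟨fun M M' h => ?_, fun P =>
    ⟨univ.filter fun x : Fin (n + 1) → α => Fin.tail x ∈ P (x 0), ?_⟩⟩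
  · ext x
    rw [← Fin.cons_self_tail x, ← mem_layer, ← mem_layer, h]
  · ext a x
    simp [mem_layer]

theorem layer_mono {M M' : Finset (Fin (n + 1) → α)} (h : M ⊆ M') (a : α) :
    layer M a ⊆ layer M' a :=
  fun _ hx => mem_layer.2 (h (mem_layer.1 hx))

theorem layer_disjoint {M M' : Finset (Fin (n + 1) → α)} (h : Disjoint M M') (a : α) :
    Disjoint (layer M a) (layer M' a) :=
  disjoint_left.2 fun _ hx hx' => disjoint_left.1 h (mem_layer.1 hx) (mem_layer.1 hx')

theorem exists_layer_nonempty {M : Finset (Fin (n + 1) → α)} (h : M.Nonempty) :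
    ∃ a, (layer M a).Nonempty := by
  obtain ⟨x, hx⟩ := h
  exact ⟨x 0, Fin.tail x, mem_layer.2 (by rwa [Fin.cons_self_tail])⟩

theorem card_eq_sum_layer (M : Finset (Fin (n + 1) → α)) : #M = ∑ a, #(layer M a) := by
  calc #M = ∑ x, if x ∈ M then 1 else 0 := by simp
    _ = ∑ p : α × (Fin n → α), if Fin.cons p.1 p.2 ∈ M then 1 else 0 :=
      ((Fin.consEquiv fun _ => α).sum_comp _).symm
    _ = ∑ a, #(layer M a) := by
      rw [Fintype.sum_prod_type]
      simp only [sum_boole, layer, Nat.cast_id]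

theorem card_eq_sum_fiber (M : Finset (Fin (n + 1) → α)) : #M = ∑ x, #(fiber M x) := by
  simp only [card_eq_sum_layer, layer, fiber, card_filter]
  exact sum_comm

theorem lineTrace_zero_cons (M : Finset (Fin (n + 1) → α)) (a : α) (x : Fin n → α) :
    lineTrace M 0 (Fin.cons a x) = fiber M x := by
  simp only [lineTrace, fiber, Fin.update_cons_zero]

theorem lineTrace_succ_cons (M : Finset (Fin (n + 1) → α)) (i : Fin n) (a : α) (x : Fin n → α) :
    lineTrace M i.succ (Fin.cons a x) = lineTrace (layer M a) i x := by
  ext b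
  rw [mem_lineTrace, mem_lineTrace, mem_layer, Fin.cons_update]

theorem LineCard.layer {p : ℕ → Prop} {M : Finset (Fin (n + 1) → α)} (h : LineCard p M) (a : α) :
    LineCard p (layer M a) :=
  fun i x => lineTrace_succ_cons M i a x ▸ h i.succ (Fin.cons a x)

theorem LineCard.fiber [Nonempty α] {p : ℕ → Prop} {M : Finset (Fin (n + 1) → α)}
    (h : LineCard p M) (x : Fin n → α) : p #(fiber M x) :=
  lineTrace_zero_cons M (Classical.arbitrary α) x ▸ h 0 _

theorem LineCard.imp {p p' : ℕ → Prop} {M : Finset (Fin n → α)} (h : LineCard p M)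
    (hp : ∀ k, p k → p' k) : LineCard p' M :=
  fun i x => hp _ (h i x)

theorem lineTrace_mono {M M' : Finset (Fin n → α)} (h : M ⊆ M') (i : Fin n) (x : Fin n → α) :
    lineTrace M i x ⊆ lineTrace M' i x :=
  fun _ ha => mem_lineTrace.2 (h (mem_lineTrace.1 ha))

theorem lineTrace_disjoint {M M' : Finset (Fin n → α)} (h : Disjoint M M') (i : Fin n)
    (x : Fin n → α) : Disjoint (lineTrace M i x) (lineTrace M' i x) :=
  disjoint_left.2 fun _ ha ha' => disjoint_left.1 h (mem_lineTrace.1 ha) (mem_lineTrace.1 ha')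

theorem lineTrace_union (M M' : Finset (Fin n → α)) (i : Fin n) (x : Fin n → α) :
    lineTrace (M ∪ M') i x = lineTrace M i x ∪ lineTrace M' i x := by
  ext a; simp only [mem_lineTrace, mem_union]

theorem lineTrace_inter (M M' : Finset (Fin n → α)) (i : Fin n) (x : Fin n → α) :
    lineTrace (M ∩ M') i x = lineTrace M i x ∩ lineTrace M' i x := by
  ext a; simp only [mem_lineTrace, mem_inter]

theorem lineTrace_sdiff (M M' : Finset (Fin n → α)) (i : Fin n) (x : Fin n → α) :
    lineTrace (M \ M') i x = lineTrace M i x \ lineTrace M' i x := by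
  ext a; simp only [mem_lineTrace, mem_sdiff]

end Lines

section Codes

variable {α : Type*} [Fintype α] [DecidableEq α] {n : ℕ}

/-- Distance-2 MDS codes: sets of words with exactly one point on every line. -/
abbrev IsMDSCode (M : Finset (Fin n → α)) : Prop := LineCard (· = 1) M

/-- Double-codes: sets of words with exactly two points on every line. -/
abbrev IsDoubleCode (M : Finset (Fin n → α)) : Prop := LineCard (· = 2) M

/-- Sets of words with no point or exactly two points on every line. Those contained in a
double-code `C` are the unions of connected components of the subgraph of the Hamming graph
induced by `C`. -/
abbrev IsEmptyOrPair (M : Finset (Fin n → α)) : Prop := LineCard (fun k => k = 0 ∨ k = 2) M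

theorem IsMDSCode.card_eq [Nonempty α] {M : Finset (Fin (n + 1) → α)} (h : IsMDSCode M) :
    #M = Fintype.card α ^ n := by
  rw [card_eq_sum_fiber, sum_congr rfl fun x _ => h.fiber x]
  simp

theorem IsMDSCode.existsUnique_mem_layer [Nonempty α] {M : Finset (Fin (n + 1) → α)}
    (h : IsMDSCode M) (x : Fin n → α) : ∃! a, x ∈ layer M a := by
  obtain ⟨a, ha⟩ := card_eq_one.1 (h.fiber x)
  simp only [← mem_fiber, ha, mem_singleton, existsUnique_eq]

theorem IsMDSCode.disjoint_layer {M : Finset (Fin (n + 1) → α)} (h : IsMDSCode M) {a b : α}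
    (hab : a ≠ b) : Disjoint (layer M a) (layer M b) :=
  have : Nonempty α := ⟨a⟩
  disjoint_left.2 fun x ha hb => hab ((h.existsUnique_mem_layer x).unique ha hb)

theorem IsMDSCode.isDoubleCode_union {P Q : Finset (Fin n → α)} (hP : IsMDSCode P)
    (hQ : IsMDSCode Q) (h : Disjoint P Q) : IsDoubleCode (P ∪ Q) := by
  intro i x
  rw [lineTrace_union, card_union_of_disjoint (lineTrace_disjoint h i x), hP i x, hQ i x]

/-- The number of MDS codes contained in `U`. -/
def codeCount (U : Finset (Fin n → α)) : ℕ := #{M : Finset (Fin n → α) | IsMDSCode M ∧ M ⊆ U}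

end Codes

section LinialLuria

theorem card_sdiff_biUnion_Iio_add_card_sdiff_biUnion_Ioi
    {β : Type*} [DecidableEq β] {k : ℕ} {P : Fin k → Finset β} {U : Finset β}
    (hP : ∀ x, ∃! i, x ∈ P i) (i : Fin k) (hU : P i ⊆ U) :
    #(U \ (Iio i).biUnion P) + #(U \ (Ioi i).biUnion P) = #U + #(P i) := by
  have hmem (x : β) (j : Fin k) (hj : x ∈ P j) (s : Finset (Fin k)) : x ∈ s.biUnion P ↔ j ∈ s := by
    rw [mem_biUnion]
    exact ⟨fun ⟨i, hi, hx⟩ => (hP x).unique hx hj ▸ hi, fun hs => ⟨j, hs, hj⟩⟩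
  have hunion : U \ (Iio i).biUnion P ∪ U \ (Ioi i).biUnion P = U := by
    ext x
    obtain ⟨j, hj, -⟩ := hP x
    simp only [mem_union, mem_sdiff, hmem x j hj, mem_Iio, mem_Ioi]
    grind
  have hinter : (U \ (Iio i).biUnion P) ∩ (U \ (Ioi i).biUnion P) = P i := by
    ext x
    obtain ⟨j, hj, huniq⟩ := hP x
    have hi : x ∈ P i ↔ i = j := ⟨huniq i, (· ▸ hj)⟩
    simp only [mem_inter, mem_sdiff, hmem x j hj, mem_Iio, mem_Ioi, hi]
    grind
  rw [← card_union_add_card_inter, hunion, hinter]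

variable {β : Type*} [Fintype β] [DecidableEq β]

theorem sum_prod_sdiff_biUnion_Iio_le_one {w : Finset β → Finset β → ℝ}
    (hw : ∀ U P, 0 ≤ w U P) (hsum : ∀ U, ∑ P, w U P ≤ 1) {k : ℕ} (V : Fin k → Finset β) :
    ∑ P : Fin k → Finset β, ∏ i, w (V i \ (Iio i).biUnion P) (P i) ≤ 1 := by
  induction k with
  | zero => simp
  | succ k ih =>
    have hIio (Q : Finset β) (P : Fin k → Finset β) (i : Fin k) :
        (Iio i.succ).biUnion (Fin.cons Q P : Fin (k + 1) → Finset β) =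
          Q ∪ (Iio i).biUnion P := by
      ext x
      simp [Fin.exists_fin_succ]
    calc ∑ P : Fin (k + 1) → Finset β, ∏ i, w (V i \ (Iio i).biUnion P) (P i)
      _ = ∑ Q, w (V 0) Q * ∑ P : Fin k → Finset β,
          ∏ i, w ((V i.succ \ Q) \ (Iio i).biUnion P) (P i) := by
        rw [← (Fin.consEquiv fun _ => Finset β).sum_comp, Fintype.sum_prod_type]
        refine sum_congr rfl fun Q _ => ?_
        rw [mul_sum]
        refine sum_congr rfl fun P _ => ?_
        have hIio_zero : Iio (0 : Fin (k + 1)) = ∅ := Iio_bot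
        rw [show Fin.consEquiv (fun _ => Finset β) (Q, P) = Fin.cons Q P from rfl]
        simp only [Fin.prod_univ_succ, hIio, hIio_zero, sdiff_sdiff_left, sup_eq_union,
          Fin.cons_zero, Fin.cons_succ, biUnion_empty, sdiff_empty]
      _ ≤ ∑ Q, w (V 0) Q := sum_le_sum fun Q _ => mul_le_of_le_one_right (hw _ _) (ih _)
      _ ≤ 1 := hsum _

theorem sum_prod_sdiff_biUnion_Ioi_le_one {w : Finset β → Finset β → ℝ}
    (hw : ∀ U P, 0 ≤ w U P) (hsum : ∀ U, ∑ P, w U P ≤ 1) {k : ℕ} (V : Fin k → Finset β) :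
    ∑ P : Fin k → Finset β, ∏ i, w (V i \ (Ioi i).biUnion P) (P i) ≤ 1 := by
  have hrev (P : Fin k → Finset β) (i : Fin k) :
      (Ioi i.rev).biUnion P = (Iio i).biUnion (P ∘ Fin.rev) := by
    ext x
    simp only [mem_biUnion, mem_Ioi, mem_Iio, Function.comp_apply]
    exact ⟨fun ⟨j, hj, hx⟩ => ⟨j.rev, by rwa [Fin.rev_lt_iff], by rwa [Fin.rev_rev]⟩,
      fun ⟨j, hj, hx⟩ => ⟨j.rev, Fin.rev_lt_rev.2 hj, hx⟩⟩
  calc ∑ P : Fin k → Finset β, ∏ i, w (V i \ (Ioi i).biUnion P) (P i)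
    _ = ∑ P : Fin k → Finset β,
        ∏ i, w ((V ∘ Fin.rev) i \ (Iio i).biUnion (P ∘ Fin.rev)) ((P ∘ Fin.rev) i) :=
      sum_congr rfl fun P _ => by
        rw [← Equiv.prod_comp Fin.revPerm]
        simp only [Fin.revPerm_apply, hrev, Function.comp_apply]
    _ = ∑ P : Fin k → Finset β, ∏ i, w ((V ∘ Fin.rev) i \ (Iio i).biUnion P) (P i) :=
      (Fin.revPerm.arrowCongr (.refl (Finset β))).sum_comp
        fun P => ∏ i, w ((V ∘ Fin.rev) i \ (Iio i).biUnion P) (P i)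
    _ ≤ 1 := sum_prod_sdiff_biUnion_Iio_le_one hw hsum _

variable {q n : ℕ}

/-- The weight of choosing the code `P` in `U`. The exponent is chosen so that, when the layers of a
code are chosen one after the other, once in increasing and once in decreasing order, the weights
multiply up to the square of the weight of the code. -/
noncomputable def codeWeight (U P : Finset (Fin (n + 1) → Fin q)) : ℝ :=
  if IsMDSCode P ∧ P ⊆ U then 2 ^ (-((#U - q ^ n : ℝ) / 2 ^ n)) else 0

theorem codeWeight_nonneg (U P : Finset (Fin (n + 1) → Fin q)) : 0 ≤ codeWeight U P := by
  unfold codeWeight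
  positivity

theorem sum_codeWeight (U : Finset (Fin (n + 1) → Fin q)) :
    ∑ P, codeWeight U P = codeCount U * 2 ^ (-((#U - q ^ n : ℝ) / 2 ^ n)) := by
  simp only [codeWeight, codeCount, ← sum_filter, sum_const, nsmul_eq_mul]

theorem codeWeight_eq_of_isMDSCode {U P : Finset (Fin (n + 1) → Fin q)} (hP : IsMDSCode P)
    (hU : P ⊆ U) : codeWeight U P = 2 ^ (-((#U - q ^ n : ℝ) / 2 ^ n)) :=
  if_pos ⟨hP, hU⟩

theorem codeCount_le_card [NeZero q] (U : Finset (Fin 1 → Fin q)) : codeCount U ≤ #U := by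
  have hpair (M : Finset (Fin 1 → Fin q)) (hM : IsMDSCode M) : ∃ x, M = {x} :=
    card_eq_one.1 (by simpa using hM.card_eq)
  calc codeCount U ≤ #(U.image singleton) := card_le_card fun M hM => by
        obtain ⟨hcode, hU⟩ := (mem_filter.1 hM).2
        obtain ⟨x, rfl⟩ := hpair M hcode
        exact mem_image_of_mem _ (singleton_subset_iff.1 hU)
    _ ≤ #U := card_image_le

theorem codeWeight_sq_eq [NeZero q] {U M : Finset (Fin (n + 2) → Fin q)} (hM : IsMDSCode M)
    (hU : M ⊆ U) :
    codeWeight U M ^ 2 = (∏ i, codeWeight (layer U i \ (Iio i).biUnion (layer M)) (layer M i)) *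
      ∏ i, codeWeight (layer U i \ (Ioi i).biUnion (layer M)) (layer M i) := by
  have hdisj (i : Fin q) (s : Finset (Fin q)) (hi : i ∉ s) :
      Disjoint (layer M i) (s.biUnion (layer M)) :=
    (disjoint_biUnion_right _ _ _).2 fun j hj => hM.disjoint_layer (by grind)
  have hsub (i : Fin q) (s : Finset (Fin q)) (hi : i ∉ s) :
      layer M i ⊆ layer U i \ s.biUnion (layer M) :=
    subset_sdiff.2 ⟨layer_mono hU i, hdisj i s hi⟩
  have hcard (i : Fin q) : (#(layer U i \ (Iio i).biUnion (layer M)) : ℝ) +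
      #(layer U i \ (Ioi i).biUnion (layer M)) = #(layer U i) + q ^ n := by
    have h := card_sdiff_biUnion_Iio_add_card_sdiff_biUnion_Ioi hM.existsUnique_mem_layer i
      (layer_mono hU i)
    rw [IsMDSCode.card_eq (hM.layer i), Fintype.card_fin] at h
    exact_mod_cast h
  have hlayer (i : Fin q) : codeWeight (layer U i \ (Iio i).biUnion (layer M)) (layer M i) *
      codeWeight (layer U i \ (Ioi i).biUnion (layer M)) (layer M i) =
        (2 : ℝ) ^ (-((#(layer U i) - q ^ n : ℝ) / 2 ^ n)) := by
    rw [codeWeight_eq_of_isMDSCode (hM.layer i) (hsub i _ (by simp)),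
      codeWeight_eq_of_isMDSCode (hM.layer i) (hsub i _ (by simp)), ← Real.rpow_add two_pos]
    congr 1
    linear_combination (-1 / 2 ^ n : ℝ) * hcard i
  have hexp : ∑ i, -((#(layer U i) - q ^ n : ℝ) / 2 ^ n) = -((#U - q ^ (n + 1) : ℝ) / 2 ^ n) := by
    rw [sum_neg_distrib, ← sum_div, sum_sub_distrib, card_eq_sum_layer U]
    simp [pow_succ']
  rw [← prod_mul_distrib, prod_congr rfl fun i _ => hlayer i, ← Real.rpow_sum_of_pos two_pos, hexp,
    codeWeight_eq_of_isMDSCode hM hU, ← Real.rpow_mul_natCast two_pos.le]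
  congr 1
  field

theorem sum_codeWeight_le_one [NeZero q] (U : Finset (Fin (n + 1) → Fin q)) :
    ∑ P, codeWeight U P ≤ 1 := by
  induction n with
  | zero =>
    have hcount : (codeCount U : ℝ) ≤ 2 ^ (#U - 1 : ℝ) := by
      rw [Real.rpow_sub_one two_ne_zero, Real.rpow_natCast, le_div_iff₀' two_pos]
      exact_mod_cast (Nat.mul_le_mul_left 2 (codeCount_le_card U)).trans
        (Nat.mul_le_pow (by simp) #U)
    rw [sum_codeWeight, pow_zero, pow_zero, div_one, Real.rpow_neg two_pos.le]
    exact mul_inv_le_one_of_le₀ hcount (by positivity)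
  | succ n ih =>
    let up : (Fin q → Finset (Fin (n + 1) → Fin q)) → ℝ :=
      fun P => ∏ i, codeWeight (layer U i \ (Iio i).biUnion P) (P i)
    let down : (Fin q → Finset (Fin (n + 1) → Fin q)) → ℝ :=
      fun P => ∏ i, codeWeight (layer U i \ (Ioi i).biUnion P) (P i)
    have hup_nonneg P : 0 ≤ up P := prod_nonneg fun _ _ => codeWeight_nonneg _ _
    have hdown_nonneg P : 0 ≤ down P := prod_nonneg fun _ _ => codeWeight_nonneg _ _
    have amgm (M : Finset (Fin (n + 2) → Fin q)) :
        codeWeight U M ≤ (up (layer M) + down (layer M)) / 2 := by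
      have hmean : 0 ≤ (up (layer M) + down (layer M)) / 2 := by
        have := hup_nonneg (layer M)
        have := hdown_nonneg (layer M)
        positivity
      by_cases hM : IsMDSCode M ∧ M ⊆ U
      · refine le_of_sq_le_sq ?_ hmean
        rw [codeWeight_sq_eq hM.1 hM.2]
        linarith [sq_nonneg (up (layer M) - down (layer M))]
      · rwa [codeWeight, if_neg hM]
    calc ∑ M, codeWeight U M
      _ ≤ ∑ M, (up (layer M) + down (layer M)) / 2 := sum_le_sum fun M _ => amgm M
      _ = ∑ P, (up P + down P) / 2 := layer_bijective.sum_comp fun P => (up P + down P) / 2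
      _ ≤ (1 + 1) / 2 := by
        rw [← sum_div, sum_add_distrib]
        gcongr
        · exact sum_prod_sdiff_biUnion_Iio_le_one codeWeight_nonneg ih _
        · exact sum_prod_sdiff_biUnion_Ioi_le_one codeWeight_nonneg ih _
      _ = 1 := by norm_num

theorem codeCount_le [NeZero q] (U : Finset (Fin (n + 1) → Fin q)) :
    (codeCount U : ℝ) ≤ 2 ^ ((#U - q ^ n : ℝ) / 2 ^ n) := by
  have h := sum_codeWeight_le_one U
  rwa [sum_codeWeight, Real.rpow_neg two_pos.le, mul_inv_le_iff₀ (by positivity), one_mul] at h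

theorem codeCount_mul_codeCount_compl_le (U : Finset (Fin (n + 1) → Fin 4)) :
    codeCount U * codeCount Uᶜ ≤ 2 ^ 2 ^ (n + 1) := by
  have hcard : (#U + #Uᶜ : ℝ) = 4 ^ (n + 1) := by
    exact_mod_cast (card_add_card_compl U).trans (by simp)
  have hexp : (#U - 4 ^ n : ℝ) / 2 ^ n + (#Uᶜ - 4 ^ n) / 2 ^ n = 2 ^ (n + 1) := by
    have h4 : (4 : ℝ) ^ n = 2 ^ n * 2 ^ n := by rw [← mul_pow]; norm_num
    field_simp
    linear_combination hcard + 2 * h4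
  have h : (codeCount U * codeCount Uᶜ : ℝ) ≤ 2 ^ (2 ^ (n + 1) : ℝ) := by
    rw [← hexp, Real.rpow_add two_pos]
    exact mul_le_mul (codeCount_le U) (codeCount_le Uᶜ) (by positivity) (by positivity)
  exact_mod_cast h

theorem codeCount_univ_le : codeCount (univ : Finset (Fin (n + 1) → Fin 4)) ≤ 2 ^ (3 * 2 ^ n) := by
  have hexp : (#(univ : Finset (Fin (n + 1) → Fin 4)) - 4 ^ n : ℝ) / 2 ^ n = 3 * 2 ^ n := by
    have h4 : (4 : ℝ) ^ n = 2 ^ n * 2 ^ n := by rw [← mul_pow]; norm_num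
    rw [card_univ, Fintype.card_fun, Fintype.card_fin, Fintype.card_fin]
    push_cast
    field_simp
    linear_combination 3 * h4
  have h := codeCount_le (univ : Finset (Fin (n + 1) → Fin 4))
  rw [Nat.cast_ofNat, hexp] at h
  exact_mod_cast h

end LinialLuria

section EmptyOrPair

variable {α : Type*} [Fintype α] [DecidableEq α] {n : ℕ} {C D K L P Q : Finset (Fin n → α)}

theorem IsDoubleCode.isEmptyOrPair (h : IsDoubleCode C) : IsEmptyOrPair C :=
  h.imp fun _ => Or.inr

theorem IsEmptyOrPair.sdiff (hD : IsEmptyOrPair D) (hK : IsEmptyOrPair K) (h : K ⊆ D) :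
    IsEmptyOrPair (D \ K) := by
  intro i x
  have hsub := lineTrace_mono h i x
  have hle := card_le_card hsub
  have := hD i x
  have := hK i x
  rw [lineTrace_sdiff, card_sdiff_of_subset hsub]
  lia

theorem IsEmptyOrPair.inter (hD : IsEmptyOrPair D) (hK : IsEmptyOrPair K) (hL : IsEmptyOrPair L)
    (hKD : K ⊆ D) (hLD : L ⊆ D) : IsEmptyOrPair (K ∩ L) := by
  intro i x
  have full {K' : Finset (Fin n → α)} (hK'D : K' ⊆ D) (h2 : #(lineTrace K' i x) = 2) :
      lineTrace K' i x = lineTrace D i x :=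
    eq_of_subset_of_card_le (lineTrace_mono hK'D i x) (by have := hD i x; lia)
  rw [lineTrace_inter]
  rcases hK i x with h | h
  · simp [card_eq_zero.1 h]
  rcases hL i x with h' | h'
  · simp [card_eq_zero.1 h']
  · rw [full hKD h, full hLD h', inter_self]
    exact hD i x

theorem IsMDSCode.isEmptyOrPair_symmDiff (hP : IsMDSCode P) (hQ : IsMDSCode Q) :
    IsEmptyOrPair (P \ Q ∪ Q \ P) := by
  intro i x
  obtain ⟨a, ha⟩ := card_eq_one.1 (hP i x)
  obtain ⟨b, hb⟩ := card_eq_one.1 (hQ i x)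
  rw [lineTrace_union, lineTrace_sdiff, lineTrace_sdiff, ha, hb]
  by_cases hab : a = b
  · simp [hab]
  · rw [sdiff_eq_self_of_disjoint (by simpa using hab),
      sdiff_eq_self_of_disjoint (by simpa using Ne.symm hab)]
    exact .inr (card_pair hab)

theorem IsEmptyOrPair.exists_two_layers {K : Finset (Fin (n + 1) → α)} (h : IsEmptyOrPair K)
    {x : Fin n → α} {a : α} (hx : x ∈ layer K a) : ∃ b ≠ a, x ∈ layer K b := by
  have : Nonempty α := ⟨a⟩
  have h2 : #(fiber K x) = 2 :=
    (h.fiber x).resolve_left (card_ne_zero_of_mem (mem_fiber.2 hx))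
  obtain ⟨b, hb, hba⟩ := exists_mem_ne (by lia : 1 < #(fiber K x)) a
  exact ⟨b, hba, mem_fiber.1 hb⟩

theorem IsEmptyOrPair.two_pow_le_card (h : IsEmptyOrPair K) (hK : K.Nonempty) : 2 ^ n ≤ #K := by
  induction n with
  | zero => simpa using hK
  | succ n ih =>
    obtain ⟨a, x, ha⟩ := exists_layer_nonempty hK
    obtain ⟨b, hba, hb⟩ := h.exists_two_layers ha
    calc 2 ^ (n + 1) = 2 ^ n + 2 ^ n := by ring
      _ ≤ #(layer K b) + #(layer K a) :=
        add_le_add (ih (h.layer b) ⟨x, hb⟩) (ih (h.layer a) ⟨x, ha⟩)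
      _ = ∑ c ∈ {b, a}, #(layer K c) := by rw [sum_pair hba]
      _ ≤ ∑ c, #(layer K c) := sum_le_sum_of_subset (subset_univ _)
      _ = #K := (card_eq_sum_layer K).symm

theorem IsEmptyOrPair.eq_of_forall_ne_layer_eq {K L : Finset (Fin (n + 1) → α)}
    (hK : IsEmptyOrPair K) (hL : IsEmptyOrPair L) (a : α)
    (h : ∀ b ≠ a, layer K b = layer L b) : K = L := by
  have : Nonempty α := ⟨a⟩
  have herase (x : Fin n → α) : (fiber K x).erase a = (fiber L x).erase a := by
    ext b
    simp only [mem_erase, mem_fiber, and_congr_right_iff]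
    intro hb
    rw [h b hb]
  refine layer_bijective.injective <| funext fun b => Finset.ext fun x => ?_
  by_cases hb : b = a
  · subst hb
    have := congrArg card (herase x)
    have := hK.fiber x
    have := hL.fiber x
    simp only [card_erase_eq_ite] at *
    grind [mem_fiber]
  · rw [h b hb]

end EmptyOrPair

section DoubleCodes

variable {n : ℕ}

theorem IsEmptyOrPair.layer_subset_layer {α : Type*} [Fintype α] [DecidableEq α]
    {K : Finset (Fin (n + 1) → α)} (hK : IsEmptyOrPair K) {a b : α}
    (h : ∀ c, c ≠ a → c ≠ b → layer K c = ∅) : layer K a ⊆ layer K b := by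
  intro x hx
  obtain ⟨c, hca, hc⟩ := hK.exists_two_layers hx
  by_cases hcb : c = b
  · exact hcb ▸ hc
  · simp [h c hca hcb] at hc

theorem IsDoubleCode.mem_layer_iff_notMem {C : Finset (Fin (n + 1) → Fin 4)}
    (hC : IsDoubleCode C) {a b c : Fin 4} (hab : a ≠ b) (hca : c ≠ a) (hcb : c ≠ b)
    (h : layer C a = layer C b) (x : Fin n → Fin 4) : x ∈ layer C c ↔ x ∉ layer C a := by
  have key : ∀ (s : Finset (Fin 4)) (a b c : Fin 4), #s = 2 → a ≠ b → c ≠ a → c ≠ b →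
      (a ∈ s ↔ b ∈ s) → (c ∈ s ↔ a ∉ s) := by decide
  simpa only [mem_fiber] using
    key (fiber C x) a b c (hC.fiber x) hab hca hcb (by rw [mem_fiber, mem_fiber, h])

theorem IsDoubleCode.eq_of_common_subset {C C' K : Finset (Fin n → Fin 4)} (hC : IsDoubleCode C)
    (hC' : IsDoubleCode C') (hK : IsEmptyOrPair K) (hne : K.Nonempty) (h : K ⊆ C) (h' : K ⊆ C') :
    C = C' := by
  induction n with
  | zero =>
    have huniv {U : Finset (Fin 0 → Fin 4)} (hU : K ⊆ U) : U = univ :=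
      (hne.mono hU).eq_univ
    rw [huniv h, huniv h']
  | succ n ih =>
    obtain ⟨a, x, ha⟩ := exists_layer_nonempty hne
    obtain ⟨b, hba, hb⟩ := hK.exists_two_layers ha
    have agree (c : Fin 4) (hc : (layer K c).Nonempty) : layer C c = layer C' c :=
      ih (hC.layer c) (hC'.layer c) (hK.layer c) hc (layer_mono h c) (layer_mono h' c)
    by_cases hc : ∃ c, c ≠ a ∧ c ≠ b ∧ (layer K c).Nonempty
    · obtain ⟨c, hca, hcb, hc⟩ := hc
      obtain ⟨d, hd⟩ : ∃ d : Fin 4, ∀ e ≠ d, e = a ∨ e = b ∨ e = c :=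
        (by decide : ∀ a b c : Fin 4, b ≠ a → c ≠ a → c ≠ b →
          ∃ d, ∀ e ≠ d, e = a ∨ e = b ∨ e = c) a b c hba hca hcb
      refine hC.isEmptyOrPair.eq_of_forall_ne_layer_eq hC'.isEmptyOrPair d fun e he => ?_
      rcases hd e he with rfl | rfl | rfl
      exacts [agree _ ⟨x, ha⟩, agree _ ⟨x, hb⟩, agree _ hc]
    · have hempty (c : Fin 4) (hca : c ≠ a) (hcb : c ≠ b) : layer K c = ∅ :=
        not_nonempty_iff_eq_empty.1 fun hne => hc ⟨c, hca, hcb, hne⟩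
      have hKab : layer K a = layer K b :=
        (hK.layer_subset_layer hempty).antisymm
          (hK.layer_subset_layer fun c hcb hca => hempty c hca hcb)
      have repeated {U : Finset (Fin (n + 1) → Fin 4)} (hU : IsDoubleCode U) (hKU : K ⊆ U) :
          layer U a = layer U b :=
        ih (hU.layer a) (hU.layer b) (hK.layer a) ⟨x, ha⟩ (layer_mono hKU a)
          (hKab ▸ layer_mono hKU b)
      refine layer_bijective.injective <| funext fun c => Finset.ext fun y => ?_
      by_cases hca : c = a
      · rw [hca, agree a ⟨x, ha⟩]
      by_cases hcb : c = b
      · rw [hcb, agree b ⟨x, hb⟩]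
      · rw [hC.mem_layer_iff_notMem hba.symm hca hcb (repeated hC h),
          hC'.mem_layer_iff_notMem hba.symm hca hcb (repeated hC' h'), agree a ⟨x, ha⟩]

end DoubleCodes

section Counting

variable {α : Type*} [Fintype α] [DecidableEq α] {n : ℕ}

theorem card_isEmptyOrPair_subset_le_two_mul {D K : Finset (Fin n → α)} (hD : IsEmptyOrPair D)
    (hK : IsEmptyOrPair K) (hKD : K ⊆ D)
    (hmin : ∀ L ⊆ K, IsEmptyOrPair L → L.Nonempty → L = K) :
    #{L | IsEmptyOrPair L ∧ L ⊆ D} ≤ 2 * #{L | IsEmptyOrPair L ∧ L ⊆ D \ K} := by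
  have alt (L : Finset (Fin n → α)) (hL : IsEmptyOrPair L ∧ L ⊆ D) : L ∩ K = ∅ ∨ L ∩ K = K :=
    (L ∩ K).eq_empty_or_nonempty.imp_right
      (hmin _ inter_subset_right (hD.inter hL.1 hK hL.2 hKD))
  calc #{L | IsEmptyOrPair L ∧ L ⊆ D}
    _ ≤ #((univ : Finset Bool) ×ˢ ({L | IsEmptyOrPair L ∧ L ⊆ D \ K} : Finset _)) := by
      refine card_le_card_of_injOn (fun L => (decide (L ∩ K = ∅), L \ K)) (fun L hL => ?_)
        fun L hL L' hL' h => ?_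
      · obtain ⟨hL, hLD⟩ := (mem_filter.1 (mem_coe.1 hL)).2
        have hdiff := hL.sdiff (hD.inter hL hK hLD hKD) inter_subset_left
        rw [sdiff_inter_self_left] at hdiff
        exact mem_coe.2 <| mem_product.2 ⟨mem_univ _, mem_filter.2
          ⟨mem_univ _, hdiff, sdiff_subset_sdiff hLD le_rfl⟩⟩
      · simp only [Prod.mk.injEq, decide_eq_decide] at h
        have hinter : L ∩ K = L' ∩ K := by
          have := alt L (mem_filter.1 (mem_coe.1 hL)).2
          have := alt L' (mem_filter.1 (mem_coe.1 hL')).2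
          grind
        rw [← sdiff_union_inter L K, ← sdiff_union_inter L' K, h.2, hinter]
    _ = 2 * #{L | IsEmptyOrPair L ∧ L ⊆ D \ K} := by
      rw [card_product, card_univ, Fintype.card_bool]

theorem card_isEmptyOrPair_subset_le {B : ℝ} (hB : 0 < B) {D : Finset (Fin n → α)}
    (hD : IsEmptyOrPair D) (h : ∀ K ⊆ D, IsEmptyOrPair K → K.Nonempty → B ≤ #K) :
    (#{L | IsEmptyOrPair L ∧ L ⊆ D} : ℝ) ≤ 2 ^ (#D / B) := by
  induction D using Finset.strongInduction with
  | H D ih =>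
    rcases D.eq_empty_or_nonempty with rfl | hne
    · have hsub : ({L : Finset (Fin n → α) | IsEmptyOrPair L ∧ L ⊆ ∅} : Finset _) ⊆ {∅} := by
        intro L hL
        simpa using (mem_filter.1 hL).2.2
      simpa using card_le_card hsub
    · obtain ⟨K, hK, hmin⟩ := exists_min_image
        ({K | IsEmptyOrPair K ∧ K ⊆ D ∧ K.Nonempty} : Finset _) card ⟨D, by simp [hD, hne]⟩
      simp only [mem_filter, mem_univ, true_and] at hK hmin
      obtain ⟨hK, hKD, hKne⟩ := hK
      have hhalf := card_isEmptyOrPair_subset_le_two_mul hD hK hKD fun L hLK hL hLne =>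
        eq_of_subset_of_card_le hLK (hmin L ⟨hL, hLK.trans hKD, hLne⟩)
      have hrest := ih (D \ K) (sdiff_ssubset hKD hKne) (hD.sdiff hK hKD)
        fun L hL => h L (hL.trans sdiff_subset)
      have hcard : (#(D \ K) : ℝ) / B + 1 ≤ #D / B := by
        have hBK := h K hKD hK hKne
        rw [card_sdiff_of_subset hKD, Nat.cast_sub (card_le_card hKD)]
        field_simp
        linarith
      calc (#{L | IsEmptyOrPair L ∧ L ⊆ D} : ℝ)
        _ ≤ 2 * #{L | IsEmptyOrPair L ∧ L ⊆ D \ K} := by exact_mod_cast hhalf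
        _ ≤ 2 * 2 ^ (#(D \ K) / B) := by gcongr
        _ = 2 ^ (#(D \ K) / B + 1) := by rw [Real.rpow_add_one two_ne_zero, mul_comm]
        _ ≤ 2 ^ (#D / B) := Real.rpow_le_rpow_of_exponent_le one_le_two hcard

theorem card_le_of_sum_two_rpow_neg_le {ι : Type*} {S T : Finset ι} {w : ι → ℝ} {c B : ℝ}
    (hST : S ⊆ T) (hw : ∀ i ∈ S, w i ≤ B) (hsum : ∑ i ∈ T, (2 : ℝ) ^ (-w i) ≤ c) :
    (#S : ℝ) ≤ c * 2 ^ B := by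
  have h : #S * (2 : ℝ) ^ (-B) ≤ c :=
    calc #S * (2 : ℝ) ^ (-B) = ∑ _i ∈ S, (2 : ℝ) ^ (-B) := by rw [sum_const, nsmul_eq_mul]
      _ ≤ ∑ i ∈ S, (2 : ℝ) ^ (-w i) := sum_le_sum fun i hi =>
        Real.rpow_le_rpow_of_exponent_le one_le_two (neg_le_neg (hw i hi))
      _ ≤ ∑ i ∈ T, (2 : ℝ) ^ (-w i) :=
        sum_le_sum_of_subset_of_nonneg hST fun _ _ _ => by positivity
      _ ≤ c := hsum
  rwa [Real.rpow_neg two_pos.le, ← div_eq_mul_inv, div_le_iff₀ (by positivity)] at h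

theorem sum_comp_le_sum_of_injOn {ι κ : Type*} {S : Finset ι} {T : Finset κ} {g : ι → κ}
    {f : κ → ℝ} (hg : Set.MapsTo g S T) (hinj : Set.InjOn g S) (hf : ∀ y ∈ T, 0 ≤ f y) :
    ∑ x ∈ S, f (g x) ≤ ∑ y ∈ T, f y := by
  classical
  rw [← sum_image (f := f) hinj]
  exact sum_le_sum_of_subset_of_nonneg (image_subset_iff.2 hg) fun y hy _ => hf y hy

theorem sum_comp_le_mul_sum_of_card_fiber_le {ι κ : Type*} [DecidableEq κ] {S : Finset ι}
    {T : Finset κ} {g : ι → κ} {f : κ → ℝ} {c : ℝ} (hg : ∀ x ∈ S, g x ∈ T)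
    (hf : ∀ y ∈ T, 0 ≤ f y) (hc : ∀ y ∈ T, #{x ∈ S | g x = y} ≤ c) :
    ∑ x ∈ S, f (g x) ≤ c * ∑ y ∈ T, f y := by
  rw [← sum_fiberwise_of_maps_to hg, mul_sum]
  refine sum_le_sum fun y hy => ?_
  rw [sum_congr rfl fun x hx => by rw [(mem_filter.1 hx).2], sum_const, nsmul_eq_mul]
  exact mul_le_mul_of_nonneg_right (hc y hy) (hf y hy)

end Counting

section PairWeight

variable {n : ℕ}

/-- The weight of a set meeting every line in `0` or `2` points. The exponent is quadratic in the
relative size because `4 ∑ xᵢ² ≤ (w + ∑ xᵢ)²` for nonnegative `xᵢ ≤ w`: the sum of the squared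
relative sizes of the layers other than a largest one is at most that of `K`. -/
noncomputable def pairWeight (K : Finset (Fin n → Fin 4)) : ℝ :=
  2 ^ (-(5 * n * (#K / 2 ^ n : ℝ) ^ 2))

theorem pairWeight_pos (K : Finset (Fin n → Fin 4)) : 0 < pairWeight K := by
  unfold pairWeight
  positivity

theorem four_mul_sum_sq_le_sq_add_sum {ι : Type*} {s : Finset ι} {x : ι → ℝ} {w : ℝ}
    (hx : ∀ i ∈ s, 0 ≤ x i) (hw : ∀ i ∈ s, x i ≤ w) :
    4 * ∑ i ∈ s, x i ^ 2 ≤ (w + ∑ i ∈ s, x i) ^ 2 := by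
  calc 4 * ∑ i ∈ s, x i ^ 2 ≤ 4 * ∑ i ∈ s, w * x i := by
        gcongr with i hi
        rw [sq]
        exact mul_le_mul_of_nonneg_right (hw i hi) (hx i hi)
    _ = 4 * w * ∑ i ∈ s, x i := by rw [← mul_sum, mul_assoc]
    _ ≤ (w + ∑ i ∈ s, x i) ^ 2 := four_mul_le_sq_add _ _

theorem pairWeight_le_prod_layer {K : Finset (Fin (n + 1) → Fin 4)} (hK : IsEmptyOrPair K)
    (hne : K.Nonempty) {a : Fin 4} (hmax : ∀ b, #(layer K b) ≤ #(layer K a)) :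
    pairWeight K ≤ 1 / 32 * ∏ j : Fin 3, pairWeight (layer K (a.succAbove j)) := by
  set x : Fin 3 → ℝ := fun j => #(layer K (a.succAbove j)) with hx
  have hcard : (#K : ℝ) = #(layer K a) + ∑ j, x j := by
    rw [card_eq_sum_layer, Fin.sum_univ_succAbove _ a]
    push_cast
    rfl
  have hlarge : (1 : ℝ) ≤ (#K / 2 ^ (n + 1)) ^ 2 := by
    refine one_le_pow₀ ((one_le_div (by positivity)).2 ?_)
    exact_mod_cast hK.two_pow_le_card hne
  have hsq : ∑ j, (x j / 2 ^ n) ^ 2 ≤ (#K / 2 ^ (n + 1) : ℝ) ^ 2 := by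
    have h := four_mul_sum_sq_le_sq_add_sum (s := univ) (x := x)
      (fun _ _ => Nat.cast_nonneg _) fun j _ => Nat.cast_le.2 (hmax (a.succAbove j))
    simp only [div_pow, ← sum_div]
    rw [hcard, div_le_div_iff₀ (by positivity) (by positivity), pow_succ 2 n, mul_pow]
    linarith [mul_le_mul_of_nonneg_right h (by positivity : (0 : ℝ) ≤ (2 ^ n) ^ 2)]
  have h32 : (1 / 32 : ℝ) = 2 ^ (-5 : ℝ) := by
    rw [Real.rpow_neg two_pos.le]
    norm_num
  simp only [pairWeight]
  rw [h32, ← Real.rpow_sum_of_pos two_pos, ← Real.rpow_add two_pos, sum_neg_distrib, ← mul_sum]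
  refine Real.rpow_le_rpow_of_exponent_le one_le_two ?_
  push_cast
  have := mul_le_mul_of_nonneg_left hsq (by positivity : (0 : ℝ) ≤ 5 * n)
  simp only [hx] at this
  linarith

theorem sum_pairWeight_largest_layer_le
    (ih : ∑ K : Finset (Fin n → Fin 4) with IsEmptyOrPair K ∧ K.Nonempty, pairWeight K ≤ 1)
    (a : Fin 4) :
    ∑ K : Finset (Fin (n + 1) → Fin 4) with
      (IsEmptyOrPair K ∧ K.Nonempty) ∧ ∀ b, #(layer K b) ≤ #(layer K a), pairWeight K ≤ 1 / 4 := by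
  set R : Finset (Finset (Fin n → Fin 4)) := {K | IsEmptyOrPair K} with hR
  have hsumR : ∑ K ∈ R, pairWeight K ≤ 2 := by
    have hsplit : R = insert ∅ ({K | IsEmptyOrPair K ∧ K.Nonempty} : Finset _) := by
      ext K
      rcases K.eq_empty_or_nonempty with rfl | hK
      · simp [hR, IsEmptyOrPair, LineCard, lineTrace]
      · simp [hR, hK, hK.ne_empty]
    have hempty : pairWeight (∅ : Finset (Fin n → Fin 4)) = 1 := by simp [pairWeight]
    rw [hsplit, sum_insert (by simp), hempty]
    linarith
  set others : Finset (Fin (n + 1) → Fin 4) → Fin 3 → Finset (Fin n → Fin 4) :=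
    fun K j => layer K (a.succAbove j)
  have hinj : Set.InjOn others {K | IsEmptyOrPair K} := fun K hK L hL h =>
    IsEmptyOrPair.eq_of_forall_ne_layer_eq hK hL a fun b hb => by
      obtain ⟨j, rfl⟩ := Fin.exists_succAbove_eq hb
      exact congrFun h j
  calc
    _ ≤ ∑ K : Finset (Fin (n + 1) → Fin 4) with
        (IsEmptyOrPair K ∧ K.Nonempty) ∧ ∀ b, #(layer K b) ≤ #(layer K a),
        1 / 32 * ∏ j, pairWeight (others K j) := by
      refine sum_le_sum fun K hK => ?_
      obtain ⟨⟨hK, hne⟩, hmax⟩ := (mem_filter.1 hK).2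
      exact pairWeight_le_prod_layer hK hne hmax
    _ ≤ ∑ p ∈ Fintype.piFinset fun _ : Fin 3 => R, 1 / 32 * ∏ j, pairWeight (p j) := by
      refine sum_comp_le_sum_of_injOn (g := others)
        (f := fun p => 1 / 32 * ∏ j, pairWeight (p j)) (fun K hK => ?_)
        (hinj.mono fun K hK => (mem_filter.1 (mem_coe.1 hK)).2.1.1) fun p _ => ?_
      · refine Fintype.mem_piFinset.2 fun j => mem_filter.2 ⟨mem_univ _, ?_⟩
        exact LineCard.layer (mem_filter.1 (mem_coe.1 hK)).2.1.1 _
      · have := prod_nonneg fun (j : Fin 3) (_ : j ∈ univ) => (pairWeight_pos (p j)).le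
        positivity
    _ = 1 / 32 * (∑ K ∈ R, pairWeight K) ^ 3 := by
      rw [← mul_sum, ← prod_univ_sum, prod_const, card_univ, Fintype.card_fin]
    _ ≤ 1 / 32 * 2 ^ 3 := by
      gcongr
      exact sum_nonneg fun K _ => (pairWeight_pos K).le
    _ = 1 / 4 := by norm_num

theorem sum_pairWeight_le_one :
    ∑ K : Finset (Fin n → Fin 4) with IsEmptyOrPair K ∧ K.Nonempty, pairWeight K ≤ 1 := by
  induction n with
  | zero =>
    have hone (K : Finset (Fin 0 → Fin 4)) : pairWeight K = 1 := by simp [pairWeight]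
    have hsub : ({K | IsEmptyOrPair K ∧ K.Nonempty} : Finset (Finset (Fin 0 → Fin 4))) ⊆ {univ} :=
      fun K hK => mem_singleton.2 (mem_filter.1 hK).2.2.eq_univ
    simpa [hone] using card_le_card hsub
  | succ n ih =>
    set T : Finset (Finset (Fin (n + 1) → Fin 4)) := {K | IsEmptyOrPair K ∧ K.Nonempty}
    have hlargest (K : Finset (Fin (n + 1) → Fin 4)) :
        ∃ a, ∀ b, #(layer K b) ≤ #(layer K a) := by
      obtain ⟨a, -, ha⟩ := exists_max_image univ (fun a => #(layer K a)) univ_nonempty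
      exact ⟨a, fun b => ha b (mem_univ b)⟩
    choose a ha using hlargest
    calc
      _ = ∑ a₀, ∑ K ∈ T with a K = a₀, pairWeight K := (sum_fiberwise T a _).symm
      _ ≤ ∑ _a₀ : Fin 4, (1 / 4 : ℝ) := by
        refine sum_le_sum fun a₀ _ =>
          (sum_le_sum_of_subset_of_nonneg (fun K hK => ?_) fun K _ _ => (pairWeight_pos K).le).trans
            (sum_pairWeight_largest_layer_le ih a₀)
        obtain ⟨hKT, rfl⟩ := mem_filter.1 hK
        exact mem_filter.2 ⟨mem_univ K, (mem_filter.1 hKT).2, ha K⟩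
      _ = 1 := by simp

theorem card_small_isEmptyOrPair_le (s : ℝ) :
    (#{K : Finset (Fin n → Fin 4) | IsEmptyOrPair K ∧ K.Nonempty ∧ #K ≤ s * 2 ^ n} : ℝ) ≤
      2 ^ (5 * n * s ^ 2) := by
  rw [← one_mul (2 ^ (5 * n * s ^ 2) : ℝ)]
  refine card_le_of_sum_two_rpow_neg_le (w := fun K => 5 * n * (#K / 2 ^ n : ℝ) ^ 2)
    (fun K hK => ?_) (fun K hK => ?_) sum_pairWeight_le_one
  · have := (mem_filter.1 hK).2
    exact mem_filter.2 ⟨mem_univ K, this.1, this.2.1⟩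
  · have := (mem_filter.1 hK).2.2.2
    gcongr
    rwa [div_le_iff₀ (by positivity)]

end PairWeight

section Splittable

variable {n : ℕ}

/-- `M` is splittable at level `s` if its last two layers together contain a nonempty union of
connected components with at most `s * 2 ^ n` points. -/
def IsSplittable (s : ℝ) (M : Finset (Fin (n + 1) → Fin 4)) : Prop :=
  ∃ K, IsEmptyOrPair K ∧ K.Nonempty ∧ #K ≤ s * 2 ^ n ∧ K ⊆ layer M 2 ∪ layer M 3

theorem IsMDSCode.compl_union_layer {M : Finset (Fin (n + 1) → Fin 4)} (h : IsMDSCode M) :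
    (layer M 0 ∪ layer M 1)ᶜ = layer M 2 ∪ layer M 3 := by
  ext x
  obtain ⟨a, ha, huniq⟩ := h.existsUnique_mem_layer x
  have hx (b : Fin 4) : x ∈ layer M b ↔ b = a := ⟨huniq b, fun hb => hb ▸ ha⟩
  simp only [mem_compl, mem_union, hx]
  clear hx huniq ha
  revert a
  decide

theorem IsMDSCode.isDoubleCode_union_layer {M : Finset (Fin (n + 1) → Fin 4)} (h : IsMDSCode M) :
    IsDoubleCode (layer M 2 ∪ layer M 3) :=
  IsMDSCode.isDoubleCode_union (h.layer 2) (h.layer 3) (h.disjoint_layer (by decide))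

theorem IsMDSCode.ext_of_layers {M M' : Finset (Fin (n + 1) → Fin 4)} (h : IsMDSCode M)
    (h' : IsMDSCode M') (hC : layer M 2 ∪ layer M 3 = layer M' 2 ∪ layer M' 3)
    (h0 : layer M 0 = layer M' 0) (h2 : layer M 2 = layer M' 2) : M = M' := by
  have hC' : layer M 0 ∪ layer M 1 = layer M' 0 ∪ layer M' 1 := by
    rw [← compl_inj_iff, h.compl_union_layer, h'.compl_union_layer, hC]
  have h1 : layer M 1 = layer M' 1 := by
    rw [← union_sdiff_cancel_left (h.disjoint_layer (zero_ne_one' (Fin 4))),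
      ← union_sdiff_cancel_left (h'.disjoint_layer (zero_ne_one' (Fin 4))), hC', h0]
  have h3 : layer M 3 = layer M' 3 := by
    rw [← union_sdiff_cancel_left (h.disjoint_layer (by decide : (2 : Fin 4) ≠ 3)),
      ← union_sdiff_cancel_left (h'.disjoint_layer (by decide : (2 : Fin 4) ≠ 3)), hC, h2]
  refine layer_bijective.injective (funext fun a => ?_)
  fin_cases a
  exacts [h0, h1, h2, h3]

theorem card_isMDSCode_subset_layer_le {K : Finset (Fin (n + 1) → Fin 4)}
    (hK : IsEmptyOrPair K) (hne : K.Nonempty) :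
    #{M : Finset (Fin (n + 2) → Fin 4) | IsMDSCode M ∧ K ⊆ layer M 2 ∪ layer M 3} ≤
      2 ^ 2 ^ (n + 1) := by
  rcases ({M : Finset (Fin (n + 2) → Fin 4) | IsMDSCode M ∧ K ⊆ layer M 2 ∪ layer M 3} :
    Finset _).eq_empty_or_nonempty with hempty | ⟨M₀, hM₀⟩
  · simp [hempty]
  simp only [mem_filter, mem_univ, true_and] at hM₀
  set C := layer M₀ 2 ∪ layer M₀ 3
  have hC {M : Finset (Fin (n + 2) → Fin 4)} (hM : IsMDSCode M)
      (hKM : K ⊆ layer M 2 ∪ layer M 3) : layer M 2 ∪ layer M 3 = C :=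
    hM.isDoubleCode_union_layer.eq_of_common_subset hM₀.1.isDoubleCode_union_layer hK hne hKM hM₀.2
  refine le_trans ?_ (codeCount_mul_codeCount_compl_le C)
  rw [codeCount, codeCount, ← card_product]
  refine card_le_card_of_injOn (fun M => (layer M 2, layer M 0)) (fun M hM => ?_)
    fun M hM M' hM' h => ?_
  · simp only [coe_filter, mem_univ, true_and, Set.mem_ofPred_eq] at hM
    simp only [coe_product, coe_filter, mem_univ, true_and, Set.mem_prod, Set.mem_ofPred_eq]
    have hCM := hC hM.1 hM.2
    refine ⟨⟨hM.1.layer 2, hCM ▸ subset_union_left⟩, hM.1.layer 0, ?_⟩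
    rw [← hCM, ← hM.1.compl_union_layer, compl_compl]
    exact subset_union_left
  · simp only [coe_filter, mem_univ, true_and, Set.mem_ofPred_eq] at hM hM'
    obtain ⟨h2, h0⟩ := Prod.mk.inj h
    exact hM.1.ext_of_layers hM'.1 ((hC hM.1 hM.2).trans (hC hM'.1 hM'.2).symm) h0 h2

open scoped Classical in
theorem card_isSplittable_le (s : ℝ) :
    (#{M : Finset (Fin (n + 2) → Fin 4) | IsMDSCode M ∧ IsSplittable s M} : ℝ) ≤
      2 ^ (5 * (n + 1 : ℕ) * s ^ 2 + 2 ^ (n + 1)) := by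
  set R : Finset (Finset (Fin (n + 1) → Fin 4)) :=
    {K | IsEmptyOrPair K ∧ K.Nonempty ∧ #K ≤ s * 2 ^ (n + 1)}
  have hcover : ({M : Finset (Fin (n + 2) → Fin 4) | IsMDSCode M ∧ IsSplittable s M} : Finset _) ⊆
      R.biUnion fun K => {M | IsMDSCode M ∧ K ⊆ layer M 2 ∪ layer M 3} := fun M hM => by
    obtain ⟨hM, K, hK, hne, hs, hKM⟩ := (mem_filter.1 hM).2
    exact mem_biUnion.2 ⟨K, mem_filter.2 ⟨mem_univ K, hK, hne, hs⟩,
      mem_filter.2 ⟨mem_univ M, hM, hKM⟩⟩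
  have hcard := (card_le_card hcover).trans <| card_biUnion_le_card_mul R _ _ fun K hK =>
    card_isMDSCode_subset_layer_le (mem_filter.1 hK).2.1 (mem_filter.1 hK).2.2.1
  calc
    _ ≤ (#R * 2 ^ 2 ^ (n + 1) : ℝ) := by exact_mod_cast hcard
    _ ≤ 2 ^ (5 * (n + 1 : ℕ) * s ^ 2) * 2 ^ 2 ^ (n + 1) := by
      gcongr
      exact card_small_isEmptyOrPair_le s
    _ = _ := by
      rw [Real.rpow_add two_pos]
      norm_cast

/- The last layers of two codes that agree in layers `0` and `1` differ by a union of components of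
the double-code formed by layers `2` and `3`, and all components of that double-code are large. -/
open scoped Classical in
theorem card_not_isSplittable_le {s : ℝ} (hs : 0 < s) (P Q : Finset (Fin n → Fin 4)) :
    (#{M : Finset (Fin (n + 1) → Fin 4) |
      (IsMDSCode M ∧ ¬ IsSplittable s M) ∧ layer M 0 = P ∧ layer M 1 = Q} : ℝ) ≤
      2 ^ (2 ^ n / s) := by
  set S : Finset (Finset (Fin (n + 1) → Fin 4)) :=
    {M | (IsMDSCode M ∧ ¬ IsSplittable s M) ∧ layer M 0 = P ∧ layer M 1 = Q} with hS
  rcases S.eq_empty_or_nonempty with hempty | ⟨M₀, hM₀⟩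
  · rw [hempty, card_empty, Nat.cast_zero]
    positivity
  simp only [hS, mem_filter, mem_univ, true_and] at hM₀
  obtain ⟨⟨hcode₀, hsplit₀⟩, hP₀, hQ₀⟩ := hM₀
  set C := layer M₀ 2 ∪ layer M₀ 3
  have hC {M : Finset (Fin (n + 1) → Fin 4)} (hM : M ∈ S) :
      IsMDSCode M ∧ layer M 0 = P ∧ layer M 2 ∪ layer M 3 = C := by
    obtain ⟨⟨hcode, -⟩, hP, hQ⟩ := (mem_filter.1 hM).2
    refine ⟨hcode, hP, ?_⟩
    change layer M 2 ∪ layer M 3 = layer M₀ 2 ∪ layer M₀ 3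
    rw [← hcode.compl_union_layer, ← hcode₀.compl_union_layer, hP, hQ, hP₀, hQ₀]
  have hinj : #S ≤ #{L : Finset (Fin n → Fin 4) | IsEmptyOrPair L ∧ L ⊆ C} := by
    refine card_le_card_of_injOn (fun M => layer M 2 \ layer M₀ 2 ∪ layer M₀ 2 \ layer M 2)
      (fun M hM => ?_) fun M hM M' hM' h => ?_
    · obtain ⟨hcode, -, hCM⟩ := hC hM
      refine mem_coe.2 (mem_filter.2 ⟨mem_univ _, ?_, union_subset ?_ ?_⟩)
      · exact IsMDSCode.isEmptyOrPair_symmDiff (hcode.layer 2) (hcode₀.layer 2)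
      · exact sdiff_subset.trans (hCM ▸ subset_union_left)
      · exact sdiff_subset.trans subset_union_left
    · obtain ⟨hcode, hP, hCM⟩ := hC hM
      obtain ⟨hcode', hP', hCM'⟩ := hC hM'
      exact hcode.ext_of_layers hcode' (hCM.trans hCM'.symm) (hP.trans hP'.symm)
        (symmDiff_left_injective (layer M₀ 2) h)
  have hcount := card_isEmptyOrPair_subset_le (B := s * 2 ^ n) (by positivity)
    hcode₀.isDoubleCode_union_layer.isEmptyOrPair fun K hKC hK hne =>
      le_of_not_ge fun hle => hsplit₀ ⟨K, hK, hne, hle, hKC⟩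
  refine (Nat.cast_le.2 hinj).trans (hcount.trans ?_)
  refine Real.rpow_le_rpow_of_exponent_le one_le_two ?_
  have hcard : (#C : ℝ) ≤ 2 ^ n * 2 ^ n := by
    have := card_le_univ C
    rw [← mul_pow]
    norm_num at this ⊢
    exact_mod_cast this
  rw [div_le_div_iff₀ (by positivity) hs]
  linarith [mul_le_mul_of_nonneg_right hcard hs.le]

end Splittable

section Leaf

variable {n : ℕ}

/-- The layers of `M` obtained by fixing the first `d` letters, indexed by the prefixes in the
letters `0` and `1`, which are encoded as vectors over `ZMod 2`. -/
def leaf : ∀ d, Finset (Fin (n + d) → Fin 4) → (Fin d → ZMod 2) → Finset (Fin n → Fin 4)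
  | 0, M, _ => M
  | d + 1, M, v => leaf d (layer (n := n + d) M (if v 0 = 0 then 0 else 1)) (Fin.tail v)

open scoped Classical in
/-- The proportion of the leaves of `M` that lie below a splittable layer, where a layer with
`n + k + 1` free coordinates is required to be splittable at level `s (n + k)`. -/
noncomputable def splitFrac (s : ℕ → ℝ) : ∀ d, Finset (Fin (n + d) → Fin 4) → ℝ
  | 0, _ => 0
  | d + 1, M => if IsSplittable (n := n + d) (s (n + d)) M then 1 else
      (splitFrac s d (layer (n := n + d) M 0) + splitFrac s d (layer (n := n + d) M 1)) / 2

/-- The number of bits needed to recover a code from its leaves when no splittable layer is met: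
by `card_not_isSplittable_le` a nonsplittable code with `n + d + 1` coordinates is determined by its
first two layers up to `2 ^ (n + d) / s (n + d)` bits. The summand `1` pays for distinguishing
splittable from nonsplittable codes. -/
noncomputable def recoveryCost (s : ℕ → ℝ) (n : ℕ) : ℕ → ℝ
  | 0 => 0
  | d + 1 => 2 * recoveryCost s n d + 1 + 2 ^ (n + d) / s (n + d)

/-- The number of bits needed to describe `M` when a splittable layer that covers `2 ^ k` leaves
costs `2 ^ k * A` bits and every leaf that is not below such a layer costs `β` bits. -/
noncomputable def codeCost (s : ℕ → ℝ) (A β : ℝ) (d : ℕ) (M : Finset (Fin (n + d) → Fin 4)) : ℝ :=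
  2 ^ d * (splitFrac s d M * A + (1 - splitFrac s d M) * β) + recoveryCost s n d

theorem IsMDSCode.leaf {d : ℕ} {M : Finset (Fin (n + d) → Fin 4)} (h : IsMDSCode M)
    (v : Fin d → ZMod 2) : IsMDSCode (leaf d M v) := by
  induction d with
  | zero => exact h
  | succ d ih => exact ih (LineCard.layer (n := n + d) h _) _

theorem leaf_disjoint {d : ℕ} {M M' : Finset (Fin (n + d) → Fin 4)} (h : Disjoint M M')
    (v : Fin d → ZMod 2) : Disjoint (leaf d M v) (leaf d M' v) := by
  induction d with
  | zero => exact h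
  | succ d ih => exact ih (layer_disjoint (n := n + d) h _) _

theorem IsMDSCode.disjoint_leaf_add_single {d : ℕ} {M : Finset (Fin (n + d) → Fin 4)}
    (h : IsMDSCode M) (v : Fin d → ZMod 2) (i : Fin d) :
    Disjoint (DoobGraph.leaf d M v) (DoobGraph.leaf d M (v + Pi.single i 1)) := by
  induction d with
  | zero => exact i.elim0
  | succ d ih =>
    unfold DoobGraph.leaf
    refine Fin.cases ?_ (fun j => ?_) i
    · have htail : Fin.tail (v + Pi.single 0 1) = Fin.tail v := by
        ext j
        simp [Fin.tail]
      rw [htail, Pi.add_apply, Pi.single_eq_same]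
      refine leaf_disjoint (IsMDSCode.disjoint_layer (n := n + d) h ?_) _
      generalize v 0 = b
      revert b
      decide
    · have htail : Fin.tail (v + Pi.single j.succ 1) = Fin.tail v + Pi.single j 1 := by
        ext k
        simp [Fin.tail, Pi.single_apply]
      rw [htail, Pi.add_apply, Pi.single_eq_of_ne (Fin.succ_ne_zero j).symm, add_zero]
      exact ih (LineCard.layer (n := n + d) h _) (Fin.tail v) j

theorem recoveryCost_nonneg {s : ℕ → ℝ} (hs : ∀ k, 0 < s k) (d : ℕ) : 0 ≤ recoveryCost s n d := by
  induction d with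
  | zero => exact le_rfl
  | succ d ih =>
    have := hs (n + d)
    unfold recoveryCost
    positivity

theorem codeCost_of_isSplittable {s : ℕ → ℝ} (hs : ∀ k, 0 < s k) (A β : ℝ) {d : ℕ}
    {M : Finset (Fin (n + (d + 1)) → Fin 4)} (hM : IsSplittable (n := n + d) (s (n + d)) M) :
    2 ^ (d + 1) * A + 1 ≤ codeCost s A β (d + 1) M := by
  have hrec := recoveryCost_nonneg (n := n) hs d
  have := hs (n + d)
  have : 0 ≤ (2 : ℝ) ^ (n + d) / s (n + d) := by positivity
  rw [codeCost, splitFrac, if_pos hM, recoveryCost]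
  linarith

theorem codeCost_of_not_isSplittable (s : ℕ → ℝ) (A β : ℝ) {d : ℕ}
    {M : Finset (Fin (n + (d + 1)) → Fin 4)} (hM : ¬ IsSplittable (n := n + d) (s (n + d)) M) :
    codeCost s A β (d + 1) M = codeCost s A β d (layer (n := n + d) M 0) +
      codeCost s A β d (layer (n := n + d) M 1) + 2 ^ (n + d) / s (n + d) + 1 := by
  simp only [codeCost, splitFrac, if_neg hM, recoveryCost]
  ring

open scoped Classical in
/-- Splittable codes of length greater than `n` are few: a splittable code of length `n + d + 1` is
described by `A` bits for each of its `2 ^ (d + 1)` leaves of length `n`. -/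
def FewSplittable (s : ℕ → ℝ) (A : ℝ) (n : ℕ) : Prop :=
  ∀ d, (#{M : Finset (Fin (n + d + 1) → Fin 4) |
    IsMDSCode M ∧ IsSplittable (s (n + d)) M} : ℝ) ≤ 2 ^ (2 ^ (d + 1) * A)

open scoped Classical in
theorem sum_splittable_two_rpow_neg_codeCost_le {s : ℕ → ℝ} (hs : ∀ k, 0 < s k) {A : ℝ} (β : ℝ)
    (hsplit : FewSplittable s A n) (d : ℕ) :
    ∑ M : Finset (Fin (n + (d + 1)) → Fin 4) with
      IsMDSCode M ∧ IsSplittable (n := n + d) (s (n + d)) M,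
      (2 : ℝ) ^ (-codeCost s A β (d + 1) M) ≤ 1 / 2 := by
  calc
    _ ≤ ∑ M : Finset (Fin (n + (d + 1)) → Fin 4) with
        IsMDSCode M ∧ IsSplittable (n := n + d) (s (n + d)) M,
        (2 : ℝ) ^ (-(2 ^ (d + 1) * A + 1)) := by
      refine sum_le_sum fun M hM => Real.rpow_le_rpow_of_exponent_le one_le_two (neg_le_neg ?_)
      exact codeCost_of_isSplittable hs A β (mem_filter.1 hM).2.2
    _ ≤ 2 ^ (2 ^ (d + 1) * A) * (2 : ℝ) ^ (-(2 ^ (d + 1) * A + 1)) := by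
      rw [sum_const, nsmul_eq_mul]
      gcongr
      exact hsplit d
    _ = 1 / 2 := by
      rw [← Real.rpow_add two_pos, neg_add, add_neg_cancel_left, Real.rpow_neg_one, one_div]

open scoped Classical in
theorem sum_not_splittable_two_rpow_neg_codeCost_le {s : ℕ → ℝ} (hs : ∀ k, 0 < s k) (A β : ℝ)
    {d : ℕ} {T : Finset (Finset (Fin (n + (d + 1)) → Fin 4))}
    {T₀ T₁ : Finset (Finset (Fin (n + d) → Fin 4))}
    (hT : ∀ M ∈ T, IsMDSCode M ∧ ¬ IsSplittable (n := n + d) (s (n + d)) M)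
    (hT₀ : ∀ M ∈ T, layer (n := n + d) M 0 ∈ T₀) (hT₁ : ∀ M ∈ T, layer (n := n + d) M 1 ∈ T₁)
    (h₀ : ∑ M ∈ T₀, (2 : ℝ) ^ (-codeCost s A β d M) ≤ 1)
    (h₁ : ∑ M ∈ T₁, (2 : ℝ) ^ (-codeCost s A β d M) ≤ 1) :
    ∑ M ∈ T, (2 : ℝ) ^ (-codeCost s A β (d + 1) M) ≤ 1 / 2 := by
  set r : ℝ := 2 ^ (n + d) / s (n + d)
  set f : Finset (Fin (n + d) → Fin 4) × Finset (Fin (n + d) → Fin 4) → ℝ := fun p =>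
    2 ^ (-codeCost s A β d p.1) * 2 ^ (-codeCost s A β d p.2) with hf
  have hterm : ∀ M ∈ T, (2 : ℝ) ^ (-codeCost s A β (d + 1) M) =
      f (layer (n := n + d) M 0, layer (n := n + d) M 1) * (2 ^ (-r) * (1 / 2)) := fun M hM => by
    have hhalf : (1 / 2 : ℝ) = 2 ^ (-1 : ℝ) := by rw [Real.rpow_neg_one, one_div]
    rw [codeCost_of_not_isSplittable s A β (hT M hM).2, hhalf]
    simp only [hf, ← Real.rpow_add two_pos, r]
    congr 1
    ring
  have hsum : ∑ M ∈ T, f (layer (n := n + d) M 0, layer (n := n + d) M 1) ≤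
      2 ^ r * ∑ p ∈ T₀ ×ˢ T₁, f p := by
    refine sum_comp_le_mul_sum_of_card_fiber_le
      (g := fun M => (layer (n := n + d) M 0, layer (n := n + d) M 1))
      (fun M hM => mem_product.2 ⟨hT₀ M hM, hT₁ M hM⟩) (fun p _ => by positivity) fun p _ => ?_
    refine le_trans (Nat.cast_le.2 (card_le_card fun M hM => ?_))
      (card_not_isSplittable_le (hs (n + d)) p.1 p.2)
    obtain ⟨hMT, rfl⟩ := mem_filter.1 hM
    exact mem_filter.2 ⟨mem_univ M, hT M hMT, rfl, rfl⟩
  have hprod : ∑ p ∈ T₀ ×ˢ T₁, f p ≤ 1 := by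
    simp only [hf, sum_product, ← mul_sum, ← sum_mul]
    exact mul_le_one₀ h₀ (sum_nonneg fun M _ => by positivity) h₁
  calc
    _ = (∑ M ∈ T, f (layer (n := n + d) M 0, layer (n := n + d) M 1)) * (2 ^ (-r) * (1 / 2)) := by
      rw [sum_congr rfl hterm, sum_mul]
    _ ≤ (2 ^ r * 1) * (2 ^ (-r) * (1 / 2)) := by
      gcongr
      exact hsum.trans (by gcongr)
    _ = 1 / 2 := by
      rw [mul_one, ← mul_assoc, ← Real.rpow_add two_pos, add_neg_cancel, Real.rpow_zero, one_mul]

open scoped Classical in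
theorem sum_two_rpow_neg_codeCost_le_one {s : ℕ → ℝ} (hs : ∀ k, 0 < s k) {A β : ℝ}
    (hsplit : FewSplittable s A n) {d : ℕ}
    {F : (Fin d → ZMod 2) → Finset (Finset (Fin n → Fin 4))} (hF : ∀ v, (#(F v) : ℝ) ≤ 2 ^ β) :
    ∑ M : Finset (Fin (n + d) → Fin 4) with IsMDSCode M ∧ ∀ v, leaf d M v ∈ F v,
      (2 : ℝ) ^ (-codeCost s A β d M) ≤ 1 := by
  induction d with
  | zero =>
    have hcost (M : Finset (Fin (n + 0) → Fin 4)) : codeCost s A β 0 M = β := by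
      simp [codeCost, splitFrac, recoveryCost]
    simp only [hcost, sum_const, nsmul_eq_mul]
    rw [Real.rpow_neg two_pos.le, ← div_eq_mul_inv, div_le_one (by positivity)]
    refine le_trans (Nat.cast_le.2 (card_le_card fun M hM => ?_)) (hF Fin.elim0)
    exact (mem_filter.1 hM).2.2 Fin.elim0
  | succ d ih =>
    set T : Finset (Finset (Fin (n + (d + 1)) → Fin 4)) :=
      {M | IsMDSCode M ∧ ∀ v, leaf (d + 1) M v ∈ F v}
    have hlayer (b : ZMod 2) : ∀ M ∈ T, layer (n := n + d) M (if b = 0 then 0 else 1) ∈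
        ({M | IsMDSCode M ∧ ∀ v, leaf d M v ∈ F (Fin.cons b v)} :
          Finset (Finset (Fin (n + d) → Fin 4))) := fun M hM => by
      obtain ⟨hcode, hleaf⟩ := (mem_filter.1 hM).2
      refine mem_filter.2 ⟨mem_univ _, LineCard.layer (n := n + d) hcode _, fun v => ?_⟩
      simpa [leaf] using hleaf (Fin.cons b v)
    have hsplittable : ∑ M ∈ T with IsSplittable (n := n + d) (s (n + d)) M,
        (2 : ℝ) ^ (-codeCost s A β (d + 1) M) ≤ 1 / 2 := by
      refine (sum_le_sum_of_subset_of_nonneg (fun M hM => ?_) fun M _ _ => by positivity).trans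
        (sum_splittable_two_rpow_neg_codeCost_le hs β hsplit d)
      obtain ⟨hM, hMs⟩ := mem_filter.1 hM
      exact mem_filter.2 ⟨mem_univ M, (mem_filter.1 hM).2.1, hMs⟩
    have hnot : ∑ M ∈ T with ¬ IsSplittable (n := n + d) (s (n + d)) M,
        (2 : ℝ) ^ (-codeCost s A β (d + 1) M) ≤ 1 / 2 :=
      sum_not_splittable_two_rpow_neg_codeCost_le hs A β
        (fun M hM => ⟨(mem_filter.1 (mem_filter.1 hM).1).2.1, (mem_filter.1 hM).2⟩)
        (fun M hM => hlayer 0 M (mem_filter.1 hM).1)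
        (fun M hM => hlayer 1 M (mem_filter.1 hM).1)
        (ih fun v => hF (Fin.cons 0 v)) (ih fun v => hF (Fin.cons 1 v))
    rw [← sum_filter_add_sum_filter_not T fun M => IsSplittable (n := n + d) (s (n + d)) M]
    exact (add_le_add hsplittable hnot).trans (by norm_num)

end Leaf

section Cube

variable {d : ℕ}

/-- Every label occurs exactly once among the neighbours of a vertex `u` of the cube, so each class
of the labelling `∑ i, u i • e i` is a perfect code: a vertex is determined by its neighbour of
label `g` and the direction leading there. -/
def neighborEquiv {Γ : Type*} [AddCommGroup Γ] [Module (ZMod 2) Γ] (e : Fin d ≃ Γ) (g : Γ) :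
    (Fin d → ZMod 2) ≃ {v // Fintype.linearCombination (ZMod 2) e v = g} × Fin d where
  toFun u :=
    let i := e.symm (g - Fintype.linearCombination (ZMod 2) e u)
    (⟨u + Pi.single i 1, by simp [i, Fintype.linearCombination_apply_single]⟩, i)
  invFun p := p.1.1 + Pi.single p.2 1
  left_inv u := by simp [add_assoc, ZModModule.add_self]
  right_inv := by
    rintro ⟨⟨v, rfl⟩, i⟩
    have hi : e.symm (-e i) = i := by rw [ZModModule.neg_eq_self, e.symm_apply_apply]
    simp [Fintype.linearCombination_apply_single, hi, add_assoc, ZModModule.add_self]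

theorem sum_prod_le_one_of_sum_pow_card_le_one {ι Γ : Type*} [Fintype Γ] [Nonempty Γ]
    {s : Finset ι} {f : Γ → ι → ℝ} (hf : ∀ g, ∀ x ∈ s, 0 ≤ f g x)
    (h : ∀ g, ∑ x ∈ s, f g x ^ Fintype.card Γ ≤ 1) : ∑ x ∈ s, ∏ g, f g x ≤ 1 := by
  set d := Fintype.card Γ with hd
  have hd0 : (d : ℝ) ≠ 0 := Nat.cast_ne_zero.2 Fintype.card_ne_zero
  have hone : ∑ _g : Γ, (d : ℝ)⁻¹ = 1 := by
    rw [sum_const, card_univ, ← hd, nsmul_eq_mul, mul_inv_cancel₀ hd0]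
  calc
    _ ≤ ∑ x ∈ s, ∑ g, (d : ℝ)⁻¹ * f g x ^ d := by
      refine sum_le_sum fun x hx => ?_
      refine le_of_eq_of_le (prod_congr rfl fun g _ => ?_) <|
        Real.geom_mean_le_arith_mean_weighted univ (fun _ : Γ => (d : ℝ)⁻¹) (fun g => f g x ^ d)
          (fun _ _ => by positivity) hone fun g _ => pow_nonneg (hf g x hx) d
      exact (Real.pow_rpow_inv_natCast (hf g x hx) (Nat.cast_ne_zero.1 hd0)).symm
    _ = ∑ g, (d : ℝ)⁻¹ * ∑ x ∈ s, f g x ^ d := by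
      rw [sum_comm]
      simp only [mul_sum]
    _ ≤ ∑ _g : Γ, (d : ℝ)⁻¹ :=
      sum_le_sum fun g _ => mul_le_of_le_one_right (by positivity) (h g)
    _ = 1 := hone

end Cube

section CubeHoms

variable {β : Type*} [DecidableEq β] {C : Finset (Finset β)} {d : ℕ}

/-- The number of members of the family `C` that are contained in `U`. -/
def countSubsets (C : Finset (Finset β)) (U : Finset β) : ℕ := #{M ∈ C | M ⊆ U}

/-- The labellings of the vertices of the `d`-dimensional cube by members of `C` in which adjacent
vertices have disjoint labels, i.e. the homomorphisms from the cube to the disjointness graph of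
`C`. -/
def cubeHoms (C : Finset (Finset β)) (d : ℕ) : Finset ((Fin d → ZMod 2) → Finset β) :=
  {X ∈ Fintype.piFinset fun _ => C | ∀ v i, Disjoint (X v) (X (v + Pi.single i 1))}

/-- The union of the labels of the neighbours of the vertex `v` of the cube. -/
def neighborUnion (X : (Fin d → ZMod 2) → Finset β) (v : Fin d → ZMod 2) : Finset β :=
  univ.biUnion fun i => X (v + Pi.single i 1)

theorem mem_cubeHoms {X : (Fin d → ZMod 2) → Finset β} :
    X ∈ cubeHoms C d ↔ (∀ v, X v ∈ C) ∧ ∀ v i, Disjoint (X v) (X (v + Pi.single i 1)) := by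
  simp [cubeHoms]

theorem card_cubeHoms_succ_le : #(cubeHoms C (d + 1)) ≤ #(cubeHoms C d) ^ 2 := by
  have hcons (b : ZMod 2) (v : Fin d → ZMod 2) (i : Fin d) :
      (Fin.cons b (v + Pi.single i 1 : Fin d → ZMod 2) : Fin (d + 1) → ZMod 2) =
        (Fin.cons b v : Fin (d + 1) → ZMod 2) + Pi.single i.succ 1 := by
    ext j
    refine Fin.cases ?_ (fun j => ?_) j <;> simp [Pi.single_apply]
  have hmaps (b : ZMod 2) {X : (Fin (d + 1) → ZMod 2) → Finset β} (hX : X ∈ cubeHoms C (d + 1)) :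
      (fun v => X (Fin.cons b v)) ∈ cubeHoms C d := by
    rw [mem_cubeHoms] at hX ⊢
    exact ⟨fun v => hX.1 _, fun v i => hcons b v i ▸ hX.2 _ _⟩
  rw [sq, ← card_product]
  refine card_le_card_of_injOn (fun X => (fun v => X (Fin.cons 0 v), fun v => X (Fin.cons 1 v)))
    (fun X hX => mem_product.2 ⟨hmaps 0 hX, hmaps 1 hX⟩) fun X _ X' _ h => ?_
  obtain ⟨h0, h1⟩ := Prod.mk.inj h
  funext v
  rw [← Fin.cons_self_tail v]
  generalize v 0 = b
  fin_cases b
  exacts [congrFun h0 _, congrFun h1 _]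

theorem sum_prod_neighborUnion_le_one {Γ : Type*} [AddCommGroup Γ] [Module (ZMod 2) Γ]
    [DecidableEq Γ] (e : Fin d ≃ Γ) (g : Γ) {q : Finset β → ℝ} (hq : ∀ U, 0 ≤ q U)
    (hsum : ∑ z ∈ Fintype.piFinset fun _ : Fin d => C, q (univ.biUnion z) ≤ 1) :
    ∑ Y ∈ Fintype.piFinset fun _ : Fin d → ZMod 2 => C,
      ∏ v with Fintype.linearCombination (ZMod 2) e v = g, q (neighborUnion Y v) ≤ 1 := by
  calc
    _ = ∑ Z ∈ Fintype.piFinset fun _ : {v // Fintype.linearCombination (ZMod 2) e v = g} =>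
        Fintype.piFinset fun _ : Fin d => C, ∏ v, q (univ.biUnion (Z v)) := by
      refine sum_equiv (((neighborEquiv e g).arrowCongr (Equiv.refl _)).trans (Equiv.curry _ _ _))
        (fun Y => ?_) fun Y _ => ?_
      · simp only [Fintype.mem_piFinset]
        exact ((neighborEquiv e g).symm.forall_congr_right (q := fun u => Y u ∈ C)).symm.trans
          Prod.forall
      · rw [prod_subtype (p := fun v => Fintype.linearCombination (ZMod 2) e v = g) _ (by simp)]
        rfl
    _ = ∏ _v : {v // Fintype.linearCombination (ZMod 2) e v = g},
        ∑ z ∈ Fintype.piFinset fun _ : Fin d => C, q (univ.biUnion z) :=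
      (prod_univ_sum _ fun _ z => q (univ.biUnion z)).symm
    _ ≤ 1 := prod_le_one (fun _ _ => sum_nonneg fun z _ => hq _) fun _ _ => hsum

variable [Fintype β]

/- Two homomorphisms are exchanged on the odd vertices, which turns disjointness along edges into a
condition on each label of the second family given the whole first family. -/
theorem card_cubeHoms_sq_le_sum :
    #(cubeHoms C d) ^ 2 ≤
      ∑ Y ∈ Fintype.piFinset fun _ : Fin d → ZMod 2 => C,
        ∏ v, countSubsets C (neighborUnion Y v)ᶜ := by
  set parity := Fintype.linearCombination (ZMod 2) fun _ : Fin d => (1 : ZMod 2)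
  have hparity (v : Fin d → ZMod 2) (i : Fin d) : parity (v + Pi.single i 1) = parity v + 1 := by
    simp [parity, Fintype.linearCombination_apply_single]
  set mix : ((Fin d → ZMod 2) → Finset β) → ((Fin d → ZMod 2) → Finset β) →
    (Fin d → ZMod 2) → Finset β := fun X X' v => if parity v = 0 then X v else X' v with hmix
  have hmix_mem {X X' : (Fin d → ZMod 2) → Finset β} (hX : X ∈ cubeHoms C d)
      (hX' : X' ∈ cubeHoms C d) (v : Fin d → ZMod 2) : mix X X' v ∈ C := by
    simp only [hmix]
    split_ifs
    exacts [(mem_cubeHoms.1 hX).1 v, (mem_cubeHoms.1 hX').1 v]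
  have hmix_disjoint {X X' : (Fin d → ZMod 2) → Finset β} (hX : X ∈ cubeHoms C d)
      (hX' : X' ∈ cubeHoms C d) (v : Fin d → ZMod 2) (i : Fin d) :
      Disjoint (mix X' X v) (mix X X' (v + Pi.single i 1)) := by
    simp only [hmix, hparity]
    rcases (by decide : ∀ a : ZMod 2, a = 0 ∨ a = 1) (parity v) with h | h
    · simpa [h] using (mem_cubeHoms.1 hX').2 v i
    · simpa [h, CharTwo.add_self_eq_zero] using (mem_cubeHoms.1 hX).2 v i
  simp only [countSubsets, ← Fintype.card_piFinset]
  rw [← card_sigma, sq, ← card_product]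
  refine card_le_card_of_injOn (fun p => ⟨mix p.1 p.2, mix p.2 p.1⟩) (fun p hp => ?_)
    fun p _ p' _ h => ?_
  · obtain ⟨hX, hX'⟩ := mem_product.1 hp
    refine mem_sigma.2 ⟨Fintype.mem_piFinset.2 (hmix_mem hX hX'), Fintype.mem_piFinset.2 fun v =>
      mem_filter.2 ⟨hmix_mem hX' hX v, ?_⟩⟩
    rw [subset_compl_iff_disjoint_right, neighborUnion, disjoint_biUnion_right]
    exact fun i _ => hmix_disjoint hX hX' v i
  · simp only [Sigma.mk.injEq, heq_eq_eq, funext_iff, hmix] at h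
    ext v : 2 <;> have h1 := h.1 v <;> have h2 := h.2 v <;> split_ifs at h1 h2 <;> assumption

theorem sum_inv_countSubsets_pow_le :
    ∑ z ∈ Fintype.piFinset fun _ : Fin d => C, ((countSubsets C (univ.biUnion z) : ℝ)⁻¹) ^ d ≤
      2 ^ Fintype.card β := by
  rw [← sum_fiberwise _ fun z : Fin d → Finset β => univ.biUnion z]
  calc
    _ ≤ ∑ _U : Finset β, (1 : ℝ) := sum_le_sum fun U _ => ?_
    _ = 2 ^ Fintype.card β := by simp
  rw [sum_congr rfl fun z hz => by rw [(mem_filter.1 hz).2], sum_const, nsmul_eq_mul, inv_pow]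
  refine mul_inv_le_one_of_le₀ ?_ (by positivity)
  rw [countSubsets, ← Nat.cast_pow, ← Fintype.card_piFinset_const]
  refine Nat.cast_le.2 (card_le_card fun z hz => ?_)
  obtain ⟨hzC, rfl⟩ := mem_filter.1 hz
  rw [Fintype.mem_piFinset] at hzC ⊢
  exact fun i => mem_filter.2 ⟨hzC i, subset_biUnion_of_mem z (mem_univ i)⟩

theorem sum_prod_inv_countSubsets_le_one {Γ : Type*} [AddCommGroup Γ] [Module (ZMod 2) Γ]
    (e : Fin d ≃ Γ) (hd : Fintype.card β ≤ d) :
    ∑ Y ∈ Fintype.piFinset fun _ : Fin d → ZMod 2 => C,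
      ∏ v, ((countSubsets C (neighborUnion Y v) : ℝ)⁻¹ * 2⁻¹) ≤ 1 := by
  classical
  let _ : Fintype Γ := Fintype.ofEquiv _ e
  have hcard : Fintype.card Γ = d := by rw [← Fintype.card_congr e, Fintype.card_fin]
  simp only [← prod_fiberwise univ (Fintype.linearCombination (ZMod 2) e)]
  refine sum_prod_le_one_of_sum_pow_card_le_one
    (fun g Y _ => prod_nonneg fun v _ => by positivity) fun g => ?_
  simp only [← prod_pow, hcard]
  refine sum_prod_neighborUnion_le_one e g
    (q := fun U => ((countSubsets C U : ℝ)⁻¹ * 2⁻¹) ^ d) (fun U => by positivity) ?_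
  simp only [mul_pow, ← sum_mul]
  rw [inv_pow 2 d, ← div_eq_mul_inv, div_le_one (by positivity)]
  exact sum_inv_countSubsets_pow_le.trans (pow_le_pow_right₀ one_le_two hd)

variable {K : ℕ}

theorem card_cubeHoms_sq_le_of_equiv
    (hK : ∀ U, countSubsets C U * countSubsets C Uᶜ ≤ K) {Γ : Type*}
    [AddCommGroup Γ] [Module (ZMod 2) Γ] (e : Fin d ≃ Γ) (hd : Fintype.card β ≤ d) :
    #(cubeHoms C d) ^ 2 ≤ (2 * K) ^ 2 ^ d := by
  have hterm : ∀ Y ∈ Fintype.piFinset fun _ : Fin d → ZMod 2 => C,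
      (∏ v, (countSubsets C (neighborUnion Y v)ᶜ : ℝ)) ≤
        (2 * K) ^ 2 ^ d * ∏ v, ((countSubsets C (neighborUnion Y v) : ℝ)⁻¹ * 2⁻¹) := by
    intro Y hY
    have hpow : (2 * K : ℝ) ^ 2 ^ d = ∏ _v : Fin d → ZMod 2, (2 * K : ℝ) := by simp
    rw [hpow, ← prod_mul_distrib]
    refine prod_le_prod (fun v _ => by positivity) fun v _ => ?_
    have hpos : 0 < countSubsets C (neighborUnion Y v) := by
      refine card_pos.2 ⟨Y (v + Pi.single (e.symm 0) 1),
        mem_filter.2 ⟨Fintype.mem_piFinset.1 hY _, ?_⟩⟩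
      exact subset_biUnion_of_mem (fun i => Y (v + Pi.single i 1)) (mem_univ (e.symm 0))
    calc
      _ ≤ (K : ℝ) / countSubsets C (neighborUnion Y v) := by
        rw [le_div_iff₀' (Nat.cast_pos.2 hpos)]
        exact_mod_cast hK (neighborUnion Y v)
      _ = _ := by ring
  have hreal : (#(cubeHoms C d) ^ 2 : ℝ) ≤ (2 * K) ^ 2 ^ d := by
    calc
      _ ≤ ∑ Y ∈ Fintype.piFinset fun _ : Fin d → ZMod 2 => C,
          ∏ v, (countSubsets C (neighborUnion Y v)ᶜ : ℝ) := by
        exact_mod_cast card_cubeHoms_sq_le_sum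
      _ ≤ (2 * K) ^ 2 ^ d * 1 := by
        refine (sum_le_sum hterm).trans ?_
        rw [← mul_sum]
        gcongr
        exact sum_prod_inv_countSubsets_le_one e hd
      _ = _ := mul_one _
  exact_mod_cast hreal

theorem card_cubeHoms_sq_le (hK : ∀ U, countSubsets C U * countSubsets C Uᶜ ≤ K) {k : ℕ}
    (hk : Fintype.card β ≤ 2 ^ k) (hd : 2 ^ k ≤ d) : #(cubeHoms C d) ^ 2 ≤ (2 * K) ^ 2 ^ d := by
  induction d, hd using Nat.le_induction with
  | base =>
    refine card_cubeHoms_sq_le_of_equiv hK (Γ := Fin k → ZMod 2) ?_ hk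
    exact (Fintype.equivFinOfCardEq (by simp)).symm
  | succ d _ ih =>
    calc
      _ ≤ (#(cubeHoms C d) ^ 2) ^ 2 := Nat.pow_le_pow_left card_cubeHoms_succ_le 2
      _ ≤ ((2 * K) ^ 2 ^ d) ^ 2 := Nat.pow_le_pow_left ih 2
      _ = _ := by rw [← pow_mul, pow_succ 2 d]

end CubeHoms

section Bootstrap

open Filter Topology

variable {n d : ℕ} {s : ℕ → ℝ} {A β θ : ℝ}

theorem card_le_of_codeCost_le (hs : ∀ k, 0 < s k) (hsplit : FewSplittable s A n)
    {F : (Fin d → ZMod 2) → Finset (Finset (Fin n → Fin 4))} (hF : ∀ v, (#(F v) : ℝ) ≤ 2 ^ β)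
    {T : Finset (Finset (Fin (n + d) → Fin 4))} (hcode : ∀ M ∈ T, IsMDSCode M)
    (hleaf : ∀ M ∈ T, ∀ v, leaf d M v ∈ F v) {B : ℝ} (hcost : ∀ M ∈ T, codeCost s A β d M ≤ B) :
    (#T : ℝ) ≤ 2 ^ B := by
  rw [← one_mul ((2 : ℝ) ^ B)]
  exact card_le_of_sum_two_rpow_neg_le
    (fun M hM => mem_filter.2 ⟨mem_univ M, hcode M hM, hleaf M hM⟩) hcost
    (sum_two_rpow_neg_codeCost_le_one hs hsplit hF)

theorem card_le_splitFrac_le (hs : ∀ k, 0 < s k) (hsplit : FewSplittable s A n)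
    (hβ : (codeCount (univ : Finset (Fin n → Fin 4)) : ℝ) ≤ 2 ^ β) (hA : A ≤ β) :
    (#{M : Finset (Fin (n + d) → Fin 4) | IsMDSCode M ∧ θ ≤ splitFrac s d M} : ℝ) ≤
      2 ^ (2 ^ d * (θ * A + (1 - θ) * β) + recoveryCost s n d) := by
  refine card_le_of_codeCost_le hs hsplit (F := fun _ => {M | IsMDSCode M ∧ M ⊆ univ})
    (fun _ => hβ) (fun M hM => (mem_filter.1 hM).2.1)
    (fun M hM v => mem_filter.2 ⟨mem_univ _, (mem_filter.1 hM).2.1.leaf v, subset_univ _⟩)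
    fun M hM => ?_
  unfold codeCost
  gcongr 2 ^ d * ?_ + _
  nlinarith [(mem_filter.1 hM).2.2]

theorem leaf_mem_cubeHoms {M : Finset (Fin (n + d) → Fin 4)} (hM : IsMDSCode M) :
    leaf d M ∈ cubeHoms {M : Finset (Fin n → Fin 4) | IsMDSCode M} d :=
  mem_cubeHoms.2 ⟨fun v => mem_filter.2 ⟨mem_univ _, hM.leaf v⟩, hM.disjoint_leaf_add_single⟩

theorem card_splitFrac_le_le (hs : ∀ k, 0 < s k) (hsplit : FewSplittable s A n) (hA : 0 ≤ A) :
    (#{M : Finset (Fin (n + d) → Fin 4) | IsMDSCode M ∧ splitFrac s d M ≤ θ} : ℝ) ≤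
      #(cubeHoms {M : Finset (Fin n → Fin 4) | IsMDSCode M} d) *
        2 ^ (2 ^ d * (θ * A) + recoveryCost s n d) := by
  rw [card_eq_sum_card_fiberwise (f := leaf d) fun M hM => leaf_mem_cubeHoms (mem_filter.1 hM).2.1,
    Nat.cast_sum, ← nsmul_eq_mul]
  refine sum_le_card_nsmul _ _ _ fun X _ => ?_
  refine card_le_of_codeCost_le hs hsplit (β := 0) (F := fun v => {X v}) (by simp)
    (fun M hM => (mem_filter.1 (mem_filter.1 hM).1).2.1)
    (fun M hM v => mem_singleton.2 (congrFun (mem_filter.1 hM).2 v)) fun M hM => ?_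
  rw [codeCost, mul_zero, add_zero]
  gcongr
  exact (mem_filter.1 (mem_filter.1 hM).1).2.2

/- Codes most of whose iterated layers are splittable are described by few bits, whereas otherwise
the leaves, a homomorphism from the cube, carry almost all the information. -/
theorem codeCount_univ_add_le (hs : ∀ k, 0 < s k) (hsplit : FewSplittable s A n)
    (hβ : (codeCount (univ : Finset (Fin n → Fin 4)) : ℝ) ≤ 2 ^ β) (hA0 : 0 ≤ A) (hA : A ≤ β) :
    (codeCount (univ : Finset (Fin (n + d) → Fin 4)) : ℝ) ≤
      2 ^ (2 ^ d * (θ * A + (1 - θ) * β) + recoveryCost s n d) +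
      #(cubeHoms {M : Finset (Fin n → Fin 4) | IsMDSCode M} d) *
        2 ^ (2 ^ d * (θ * A) + recoveryCost s n d) := by
  refine le_trans ?_ (add_le_add (card_le_splitFrac_le (θ := θ) hs hsplit hβ hA)
    (card_splitFrac_le_le hs hsplit hA0))
  rw [codeCount, ← Nat.cast_add]
  refine Nat.cast_le.2 ((card_le_card fun M hM => ?_).trans (card_union_le _ _))
  have hM := (mem_filter.1 hM).2.1
  rw [← filter_or, mem_filter, ← and_or_left]
  exact ⟨mem_univ M, hM, le_total _ _⟩

theorem card_cubeHoms_codes_le (hd : 4 ^ (n + 1) ≤ d) :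
    (#(cubeHoms {M : Finset (Fin (n + 1) → Fin 4) | IsMDSCode M} d) : ℝ) ≤
      2 ^ (2 ^ d * (2 ^ n + 1 / 2) : ℝ) := by
  have h4 : 4 ^ (n + 1) = 2 ^ (2 * (n + 1)) := by rw [pow_mul]; norm_num
  have hsq := card_cubeHoms_sq_le (C := {M : Finset (Fin (n + 1) → Fin 4) | IsMDSCode M})
    (K := 2 ^ 2 ^ (n + 1)) (k := 2 * (n + 1)) (d := d)
    (fun U => by
      simpa only [countSubsets, codeCount, filter_filter] using codeCount_mul_codeCount_compl_le U)
    (by simp [h4]) (h4 ▸ hd)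
  have hexp : (2 : ℝ) ^ d * (2 ^ n + 1 / 2) * (2 : ℕ) = ((1 + 2 ^ (n + 1)) * 2 ^ d : ℕ) := by
    push_cast
    ring
  rw [← pow_le_pow_iff_left₀ (by positivity) (by positivity) two_ne_zero,
    ← Real.rpow_mul_natCast two_pos.le, hexp, Real.rpow_natCast, pow_mul, pow_add, pow_one]
  exact_mod_cast hsq

theorem codeCount_univ_add_le_two_mul (hs : ∀ k, 0 < s k) {t η : ℝ} (ht : 0 ≤ t) (hη : 0 ≤ η)
    (hsplit : FewSplittable s ((1 + η) * 2 ^ n) (n + 1))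
    (hn : (codeCount (univ : Finset (Fin (n + 1) → Fin 4)) : ℝ) ≤ 2 ^ ((1 + t) * 2 ^ n))
    (hd : 4 ^ (n + 1) ≤ d) :
    (codeCount (univ : Finset (Fin (n + 1 + d) → Fin 4)) : ℝ) ≤
      2 * 2 ^ ((1 + t / (1 + t) + η) * (2 ^ n * 2 ^ d) + 2 ^ d + recoveryCost s (n + 1) d) := by
  set θ := t / (1 + t) with hθ
  have hθt : (1 - θ) * t = θ := by rw [hθ]; field_simp; ring
  have hθ1 : θ ≤ 1 := div_le_one_of_le₀ (by linarith) (by linarith)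
  have hd0 : (0 : ℝ) ≤ 2 ^ d := by positivity
  have hhigh : (2 : ℝ) ^ d * (θ * ((1 + η) * 2 ^ n) + (1 - θ) * ((1 + η + t) * 2 ^ n)) ≤
      (1 + θ + η) * (2 ^ n * 2 ^ d) + 2 ^ d :=
    calc _ = (1 + (1 - θ) * t + η) * (2 ^ n * 2 ^ d) := by ring
      _ ≤ _ := by rw [hθt]; exact le_add_of_nonneg_right hd0
  have hlow : (2 : ℝ) ^ d * (2 ^ n + 1 / 2) + 2 ^ d * (θ * ((1 + η) * 2 ^ n)) ≤
      (1 + θ + η) * (2 ^ n * 2 ^ d) + 2 ^ d :=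
    calc _ = (1 + θ + θ * η) * (2 ^ n * 2 ^ d) + 2 ^ d / 2 := by ring
      _ ≤ _ := by
        gcongr
        exacts [mul_le_of_le_one_left hη hθ1, half_le_self hd0]
  refine (codeCount_univ_add_le (n := n + 1) (d := d) (β := (1 + η + t) * 2 ^ n) (θ := θ) hs hsplit
    ?_ (by positivity) ?_).trans ?_
  · refine hn.trans (Real.rpow_le_rpow_of_exponent_le one_le_two ?_)
    gcongr
    linarith
  · exact mul_le_mul_of_nonneg_right (by linarith) (by positivity)
  · rw [two_mul]
    refine add_le_add (Real.rpow_le_rpow_of_exponent_le one_le_two (by gcongr))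
      ((mul_le_mul_of_nonneg_right (card_cubeHoms_codes_le hd) (by positivity)).trans ?_)
    rw [← Real.rpow_add two_pos, ← add_assoc]
    exact Real.rpow_le_rpow_of_exponent_le one_le_two (by gcongr)

/-- The threshold of splittability used at length `k`. Its square times `k` is negligible against
`2 ^ k`, and `2 ^ k / splitBound k` is negligible as well. -/
noncomputable def splitBound (k : ℕ) : ℝ := (4 / 3) ^ k

theorem splitBound_pos (k : ℕ) : 0 < splitBound k := by
  unfold splitBound
  positivity

theorem recoveryCost_splitBound (n d : ℕ) : recoveryCost splitBound n d =
    (1 + 2 * (3 / 2) ^ n) * 2 ^ d - 1 - 2 * (3 / 2) ^ n * (3 / 2) ^ d := by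
  induction d with
  | zero => simp [recoveryCost]
  | succ d ih =>
    have hdiv : (2 : ℝ) ^ (n + d) / (4 / 3) ^ (n + d) = (3 / 2) ^ n * (3 / 2) ^ d := by
      rw [← div_pow, pow_add]
      norm_num
    rw [recoveryCost, ih, splitBound, hdiv]
    ring

theorem recoveryCost_splitBound_le (n d : ℕ) :
    recoveryCost splitBound n d ≤ (1 + 2 * (3 / 2) ^ n) * 2 ^ d := by
  have : (0 : ℝ) < 2 * (3 / 2) ^ n * (3 / 2) ^ d := by positivity
  rw [recoveryCost_splitBound]
  linarith

open scoped Classical in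
theorem card_isSplittable_splitBound_le {η : ℝ} (hη : 5 * ((n + 1 : ℕ) * (8 / 9) ^ (n + 1)) ≤ η) :
    (#{M : Finset (Fin (n + 2) → Fin 4) | IsMDSCode M ∧ IsSplittable (splitBound (n + 1)) M} : ℝ) ≤
      2 ^ ((1 + η) * 2 ^ (n + 1)) := by
  refine (card_isSplittable_le _).trans (Real.rpow_le_rpow_of_exponent_le one_le_two ?_)
  have hsq : splitBound (n + 1) ^ 2 = (8 / 9) ^ (n + 1) * 2 ^ (n + 1) := by
    rw [splitBound, ← pow_mul, mul_comm (n + 1) 2, pow_mul, ← mul_pow]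
    norm_num
  rw [hsq]
  nlinarith [mul_le_mul_of_nonneg_right hη (by positivity : (0 : ℝ) ≤ 2 ^ (n + 1))]

theorem codeCount_univ_add_le_of_splitBound {t η : ℝ} (ht : 0 ≤ t)
    (hsmall : ∀ k ≥ n + 1, 5 * ((k : ℝ) * (8 / 9) ^ k) ≤ η)
    (hrec : 3 + 2 * (3 / 2) ^ (n + 1) ≤ η * 2 ^ n)
    (hn : (codeCount (univ : Finset (Fin (n + 1) → Fin 4)) : ℝ) ≤ 2 ^ ((1 + t) * 2 ^ n))
    (hd : 4 ^ (n + 1) ≤ d) :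
    (codeCount (univ : Finset (Fin (n + 1 + d) → Fin 4)) : ℝ) ≤
      2 ^ ((1 + (t / (1 + t) + 2 * η)) * 2 ^ (n + d)) := by
  have hη : 0 ≤ η := le_trans (by positivity) (hsmall (n + 1) le_rfl)
  have hsplit : FewSplittable splitBound ((1 + η) * 2 ^ n) (n + 1) := fun e => by
    have hexp : (2 : ℝ) ^ (e + 1) * ((1 + η) * 2 ^ n) = (1 + η) * 2 ^ (n + e + 1) := by ring
    rw [hexp]
    have h := card_isSplittable_splitBound_le (hsmall (n + e + 1) (by lia))
    rwa [add_right_comm n 1 e]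
  have hcost : 1 + (2 ^ d + recoveryCost splitBound (n + 1) d) ≤ η * (2 ^ n * 2 ^ d) :=
    calc
      _ ≤ (2 : ℝ) ^ d + (2 ^ d + (1 + 2 * (3 / 2) ^ (n + 1)) * 2 ^ d) := by
        gcongr
        exacts [one_le_pow₀ one_le_two, recoveryCost_splitBound_le (n + 1) d]
      _ = (3 + 2 * (3 / 2) ^ (n + 1)) * 2 ^ d := by ring
      _ ≤ η * 2 ^ n * 2 ^ d := by gcongr
      _ = _ := mul_assoc _ _ _
  refine (codeCount_univ_add_le_two_mul splitBound_pos ht hη hsplit hn hd).trans ?_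
  nth_rewrite 1 [← Real.rpow_one 2]
  rw [← Real.rpow_add two_pos, pow_add]
  exact Real.rpow_le_rpow_of_exponent_le one_le_two (by linarith)

/-- The number of MDS codes of length `N` is at most `2 ^ ((1 + t) * 2 ^ (N - 1))` for all large
`N`. -/
def EventuallyBounded (t : ℝ) : Prop :=
  ∀ᶠ N in atTop, (codeCount (univ : Finset (Fin (N + 1) → Fin 4)) : ℝ) ≤ 2 ^ ((1 + t) * 2 ^ N)

theorem eventuallyBounded_two : EventuallyBounded 2 := by
  refine Eventually.of_forall fun N => ?_
  have h : (codeCount (univ : Finset (Fin (N + 1) → Fin 4)) : ℝ) ≤ 2 ^ (3 * 2 ^ N) := by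
    exact_mod_cast codeCount_univ_le
  refine h.trans_eq ?_
  rw [← Real.rpow_natCast]
  norm_num

theorem EventuallyBounded.mono {t t' : ℝ} (h : EventuallyBounded t) (htt' : t ≤ t') :
    EventuallyBounded t' := by
  filter_upwards [h] with N hN
  refine hN.trans (Real.rpow_le_rpow_of_exponent_le one_le_two ?_)
  gcongr

theorem EventuallyBounded.improve {t δ : ℝ} (ht : 0 ≤ t) (h : EventuallyBounded t) (hδ : 0 < δ) :
    EventuallyBounded (t / (1 + t) + δ) := by
  have hδ2 : 0 < δ / 2 := by positivity
  have hsplit : Tendsto (fun k : ℕ => 5 * ((k : ℝ) * (8 / 9) ^ k)) atTop (𝓝 0) := by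
    simpa using (tendsto_self_mul_const_pow_of_lt_one (r := 8 / 9) (by norm_num)
      (by norm_num)).const_mul 5
  have hrec : Tendsto (fun n : ℕ => 3 * (1 / 2 : ℝ) ^ n + 3 * (3 / 4) ^ n) atTop (𝓝 0) := by
    simpa using ((tendsto_pow_atTop_nhds_zero_of_lt_one (r := (1 / 2 : ℝ)) (by norm_num)
      (by norm_num)).const_mul 3).add ((tendsto_pow_atTop_nhds_zero_of_lt_one (r := (3 / 4 : ℝ))
      (by norm_num) (by norm_num)).const_mul 3)
  obtain ⟨n, hn, hnsplit, hnrec⟩ :=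
    (h.and ((eventually_forall_ge_atTop.2 (hsplit.eventually (ge_mem_nhds hδ2))).and
      (hrec.eventually (ge_mem_nhds hδ2)))).exists
  refine eventually_atTop.2 ⟨n + 4 ^ (n + 1), fun N hN => ?_⟩
  obtain ⟨d, rfl⟩ := Nat.exists_eq_add_of_le ((Nat.le_add_right _ _).trans hN)
  have hnrec : 3 + 2 * (3 / 2 : ℝ) ^ (n + 1) ≤ δ / 2 * 2 ^ n :=
    calc 3 + 2 * (3 / 2 : ℝ) ^ (n + 1) = (3 * (1 / 2) ^ n + 3 * (3 / 4) ^ n) * 2 ^ n := by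
          rw [add_mul, mul_assoc, mul_assoc, ← mul_pow, ← mul_pow, pow_succ]
          norm_num
          ring
      _ ≤ _ := by gcongr
  have hbound := codeCount_univ_add_le_of_splitBound ht (fun k hk => hnsplit k (by lia)) hnrec hn
    (Nat.le_of_add_le_add_left hN)
  rwa [mul_div_cancel₀ δ two_ne_zero, add_right_comm] at hbound

theorem eventuallyBounded_of_pos {η : ℝ} (hη : 0 < η) : EventuallyBounded η := by
  set T := {t : ℝ | 0 ≤ t ∧ EventuallyBounded t}
  have hne : T.Nonempty := ⟨2, by norm_num, eventuallyBounded_two⟩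
  have hbdd : BddBelow T := ⟨0, fun t ht => ht.1⟩
  have hinf : 0 ≤ sInf T := le_csInf hne fun t ht => ht.1
  have hle : ∀ t ∈ T, sInf T * (1 + t) ≤ t := by
    rintro t ⟨ht, htT⟩
    rw [← le_div_iff₀ (by positivity)]
    exact le_of_forall_pos_le_add fun δ hδ => csInf_le hbdd ⟨by positivity, htT.improve ht hδ⟩
  have hsq : sInf T + sInf T ^ 2 ≤ sInf T := by
    refine le_csInf hne fun t ht => ?_
    nlinarith [hle t ht, csInf_le hbdd ht]
  have hzero : sInf T = 0 := by nlinarith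
  obtain ⟨t, ht, htη⟩ := exists_lt_of_csInf_lt hne (hzero.trans_lt hη)
  exact ht.2.mono htη.le

end Bootstrap

local notation "K₄" => (⊤ : SimpleGraph (Fin 4))

section BoxProd

variable {U V W : Type*} {G : SimpleGraph V} {H : SimpleGraph U} {R : SimpleGraph W}

theorem isIndepSet_map_iso (e : G ≃g H) {S : Finset V} (hS : G.IsIndepSet S) :
    H.IsIndepSet (S.map e.toEquiv.toEmbedding) := by
  rw [coe_map]
  rintro _ ⟨v, hv, rfl⟩ _ ⟨v', hv', rfl⟩ hne hadj
  exact hS hv hv' (fun h => hne (by rw [h])) (e.map_adj_iff.1 hadj)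

variable [Fintype V]

/-- No independent set of `G` contains more than a quarter of the vertices. The factors of a Doob
graph have this property, and it passes to products. -/
def HasQuarterBound (G : SimpleGraph V) : Prop :=
  ∀ S : Finset V, G.IsIndepSet S → 4 * #S ≤ Fintype.card V

open scoped Classical in
/-- The independent sets that contain exactly a quarter of the vertices. -/
noncomputable def quarterSets (G : SimpleGraph V) : Finset (Finset V) :=
  {S | G.IsIndepSet S ∧ 4 * #S = Fintype.card V}

open scoped Classical in
/-- The part of `S` over the point `w` of the second factor. -/
noncomputable def slice (S : Finset (V × W)) (w : W) : Finset V :=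
  {v | (v, w) ∈ S}

theorem mem_quarterSets {S : Finset V} :
    S ∈ quarterSets G ↔ G.IsIndepSet S ∧ 4 * #S = Fintype.card V := by
  simp [quarterSets]

theorem mem_slice {S : Finset (V × W)} {v : V} {w : W} : v ∈ slice S w ↔ (v, w) ∈ S := by
  simp [slice]

theorem slice_injective : Function.Injective (slice : Finset (V × W) → W → Finset V) := by
  intro S T h
  ext ⟨v, w⟩
  rw [← mem_slice, h, mem_slice]

theorem isIndepSet_boxProd_iff {S : Finset (V × W)} :
    (G □ R).IsIndepSet S ↔ (∀ w, G.IsIndepSet (slice S w)) ∧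
      ∀ w w', R.Adj w w' → Disjoint (slice S w) (slice S w') := by
  simp only [SimpleGraph.IsIndepSet, Set.Pairwise, SetLike.mem_coe, Prod.forall,
    SimpleGraph.boxProd_adj, Finset.disjoint_left, mem_slice]
  constructor
  · refine fun h => ⟨fun w v hv v' hv' hne hadj => ?_, fun w w' hadj v hv hv' => ?_⟩
    · exact h v w hv v' w hv' (by simpa using hne) (.inl ⟨hadj, rfl⟩)
    · exact h v w hv v w' hv' (by simpa using hadj.ne) (.inr ⟨hadj, rfl⟩)
  · rintro ⟨hind, hdisj⟩ v w hv v' w' hv' - (⟨hadj, rfl⟩ | ⟨hadj, rfl⟩)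
    · exact hind w hv hv' hadj.ne hadj
    · exact hdisj w w' hadj hv hv'

variable [Fintype W]

theorem sum_card_slice (S : Finset (V × W)) : ∑ w, #(slice S w) = #S := by
  classical
  have h : #S = ∑ p, if p ∈ S then 1 else 0 := by simp
  rw [h, Fintype.sum_prod_type_right]
  simp [slice]

theorem HasQuarterBound.boxProd (hG : HasQuarterBound G) (R : SimpleGraph W) :
    HasQuarterBound (G □ R) := by
  intro S hS
  calc 4 * #S = ∑ w, 4 * #(slice S w) := by rw [← sum_card_slice, mul_sum]
    _ ≤ ∑ _w : W, Fintype.card V := sum_le_sum fun w _ => hG _ ((isIndepSet_boxProd_iff.1 hS).1 w)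
    _ = Fintype.card (V × W) := by simp [mul_comm]

theorem mem_quarterSets_boxProd_iff (hG : HasQuarterBound G) {S : Finset (V × W)} :
    S ∈ quarterSets (G □ R) ↔ (∀ w, slice S w ∈ quarterSets G) ∧
      ∀ w w', R.Adj w w' → Disjoint (slice S w) (slice S w') := by
  simp only [mem_quarterSets, isIndepSet_boxProd_iff, forall_and, and_right_comm]
  refine and_congr_left' (and_congr_right fun hind => ?_)
  rw [← sum_card_slice, mul_sum, Fintype.card_prod, mul_comm (Fintype.card V),
    show Fintype.card W * Fintype.card V = ∑ _w : W, Fintype.card V by simp,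
    sum_eq_sum_iff_of_le fun w _ => hG _ (hind w)]
  simp

variable [Fintype U]

theorem card_quarterSets_boxProd_le (hG : HasQuarterBound G) (hH : HasQuarterBound H)
    (R : SimpleGraph W) {Φ : Finset V → Finset U}
    (hmaps : ∀ S ∈ quarterSets G, Φ S ∈ quarterSets H)
    (hinj : Set.InjOn Φ (quarterSets G))
    (hdisj : ∀ S ∈ quarterSets G, ∀ T ∈ quarterSets G, Disjoint S T → Disjoint (Φ S) (Φ T)) :
    #(quarterSets (G □ R)) ≤ #(quarterSets (H □ R)) := by
  classical
  let Ψ (S : Finset (V × W)) : Finset (U × W) := {p | p.1 ∈ Φ (slice S p.2)}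
  have hΨ (S : Finset (V × W)) (w : W) : slice (Ψ S) w = Φ (slice S w) := by
    ext u
    simp [Ψ, mem_slice]
  refine card_le_card_of_injOn Ψ (fun S hS => ?_) fun S hS T hT h => ?_
  · rw [mem_coe, mem_quarterSets_boxProd_iff hG] at hS
    rw [mem_coe, mem_quarterSets_boxProd_iff hH]
    simp only [hΨ]
    exact ⟨fun w => hmaps _ (hS.1 w), fun w w' hadj =>
      hdisj _ (hS.1 w) _ (hS.1 w') (hS.2 w w' hadj)⟩
  · rw [mem_coe, mem_quarterSets_boxProd_iff hG] at hS hT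
    refine slice_injective (funext fun w => hinj (hS.1 w) (hT.1 w) ?_)
    rw [← hΨ, ← hΨ, h]

theorem HasQuarterBound.of_iso (hH : HasQuarterBound H) (e : G ≃g H) : HasQuarterBound G := by
  intro S hS
  simpa [Fintype.card_congr e.toEquiv] using hH _ (isIndepSet_map_iso e hS)

theorem map_iso_mem_quarterSets (e : G ≃g H) {S : Finset V} (hS : S ∈ quarterSets G) :
    S.map e.toEquiv.toEmbedding ∈ quarterSets H := by
  rw [mem_quarterSets] at hS ⊢
  exact ⟨isIndepSet_map_iso e hS.1, by rw [card_map, hS.2, Fintype.card_congr e.toEquiv]⟩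

theorem card_quarterSets_le_of_iso (e : G ≃g H) : #(quarterSets G) ≤ #(quarterSets H) :=
  card_le_card_of_injOn (fun S => S.map e.toEquiv.toEmbedding)
    (fun _ => map_iso_mem_quarterSets e) (map_injective _).injOn

theorem hasQuarterBound_top : HasQuarterBound K₄ := by
  intro S hS
  have hcard : #S ≤ 1 := card_le_one.2 fun a ha b hb => by_contra fun hab => hS ha hb hab hab
  rw [Fintype.card_fin]
  lia

end BoxProd

section CartesianPower

variable {V V' W W' : Type*} (G : SimpleGraph V)

/-- One coordinate of a Cartesian power as a factor of a product. -/
def cartesianPowerSucc {k : ℕ} (i : Fin (k + 1)) :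
    cartesianPower G (k + 1) ≃g (G □ cartesianPower G k) where
  toEquiv := (Fin.insertNthEquiv (fun _ => V) i).symm
  map_rel_iff' := by
    intro x y
    simp only [Fin.insertNthEquiv_symm_apply, SimpleGraph.boxProd_adj, cartesianPower,
      Fin.exists_iff_succAbove i, Fin.forall_iff_succAbove i, Fin.removeNth_apply, funext_iff]
    simp [Fin.succAbove_ne, (Fin.succAbove_ne i _).symm, and_comm, and_left_comm]

variable {G} {G' : SimpleGraph V'} {H : SimpleGraph W} {H' : SimpleGraph W'}

/-- Products of isomorphic graphs are isomorphic. -/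
def boxProdCongr (e : G ≃g G') (f : H ≃g H') : (G □ H) ≃g (G' □ H') where
  toEquiv := e.toEquiv.prodCongr f.toEquiv
  map_rel_iff' := by
    have he (v v' : V) : G'.Adj (e v) (e v') ↔ G.Adj v v' := e.map_adj_iff
    have hf (w w' : W) : H'.Adj (f w) (f w') ↔ H.Adj w w' := f.map_adj_iff
    simp [SimpleGraph.boxProd_adj, he, hf]

end CartesianPower

section Shrikhande

instance : DecidableRel shrikhande.Adj := fun u v =>
  decidable_of_iff (u - v ∈ ({(1, 0), (0, 1), (1, 1), (3, 0), (0, 3), (3, 3)} :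
    Finset (ZMod 4 × ZMod 4))) <| by
    simp only [shrikhande, SimpleGraph.circulantGraph, SimpleGraph.fromRel_adj,
      Set.mem_insert_iff, Set.mem_singleton_iff]
    revert u v
    decide +kernel

/-- Four labellings of the vertices of the Shrikhande graph. Their fibres are the sixteen
independent sets of size four: the cosets of the subgroup `2ℤ₄²` and of three cyclic subgroups. -/
def shrikhandeLabel : Fin 4 → ZMod 4 × ZMod 4 → ZMod 4 :=
  ![fun x => x.1 ^ 2 + 2 * x.2 ^ 2, fun x => x.1 + 2 * x.2, fun x => 2 * x.1 + x.2,
    fun x => x.1 + x.2]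

/-- Four labellings of the vertices of `K₄ □ K₄`. Each fibre is the graph of a permutation, since
`^^^` makes `Fin 4` a group; `f` and `g` were chosen so that fibres with the same indices as
disjoint fibres of `shrikhandeLabel` are disjoint. -/
def hammingLabel (k : Fin 4) (x : Fin 4 × Fin 4) : ZMod 4 :=
  let f : Equiv.Perm (Fin 4) := ![1, 1, Equiv.swap 1 2, Equiv.swap 2 3] k
  let g : Equiv.Perm (Fin 4) := ![1, Equiv.swap 1 3, Equiv.swap 2 3, Equiv.swap 1 2] k
  (f (x.1 ^^^ g x.2)).val

/-- The set of points to which the labelling with index `i.1` gives the label `i.2`. -/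
def labelClass {V : Type*} [Fintype V] (label : Fin 4 → V → ZMod 4) (i : Fin 4 × ZMod 4) :
    Finset V :=
  {x | label i.1 x = i.2}

theorem card_labelClass_shrikhandeLabel : ∀ i, #(labelClass shrikhandeLabel i) = 4 := by
  decide +kernel

theorem exists_adj_of_notMem_labelClass :
    ∀ i, ∀ u ∉ labelClass shrikhandeLabel i,
      ∃ v ∈ labelClass shrikhandeLabel i, shrikhande.Adj u v := by
  decide +kernel

theorem labelClass_hammingLabel_injective : Function.Injective (labelClass hammingLabel) := by
  decide +kernel

theorem disjoint_labelClass_hammingLabel :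
    ∀ i j, Disjoint (labelClass shrikhandeLabel i) (labelClass shrikhandeLabel j) →
      Disjoint (labelClass hammingLabel i) (labelClass hammingLabel j) := by
  decide +kernel

theorem card_labelClass_hammingLabel : ∀ i, #(labelClass hammingLabel i) = 4 := by
  decide +kernel

theorem fst_eq_iff_of_hammingLabel_eq :
    ∀ k, ∀ x y, hammingLabel k x = hammingLabel k y → (x.1 = y.1 ↔ x.2 = y.2) := by
  decide +kernel

/- The quantifiers alternate with the hypotheses so that the exhaustive search is pruned early. -/
theorem exists_shrikhandeLabel_eq :
    ∀ a b, shrikhandeᶜ.Adj a b → ∀ c, shrikhandeᶜ.Adj a c ∧ shrikhandeᶜ.Adj b c →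
      ∀ d, shrikhandeᶜ.Adj a d ∧ shrikhandeᶜ.Adj b d ∧ shrikhandeᶜ.Adj c d →
        ∃ k, shrikhandeLabel k b = shrikhandeLabel k a ∧
          shrikhandeLabel k c = shrikhandeLabel k a ∧
            shrikhandeLabel k d = shrikhandeLabel k a := by
  decide +kernel

theorem exists_labelClass_eq {S : Finset (ZMod 4 × ZMod 4)} (hS : shrikhande.IsIndepSet S)
    (hcard : #S = 4) : ∃ i, labelClass shrikhandeLabel i = S := by
  rw [← SimpleGraph.isClique_compl] at hS
  obtain ⟨a, b, c, d, hab, hac, had, hbc, hbd, hcd, rfl⟩ := Finset.card_eq_four.1 hcard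
  simp only [coe_insert, coe_singleton, SimpleGraph.isClique_insert, Set.mem_insert_iff,
    Set.mem_singleton_iff, forall_eq_or_imp, forall_eq] at hS
  obtain ⟨⟨⟨-, hcd'⟩, hbc', hbd'⟩, hab', hac', had'⟩ := hS
  obtain ⟨k, hb, hc, hd⟩ := exists_shrikhandeLabel_eq a b (hab' hab) c ⟨hac' hac, hbc' hbc⟩ d
    ⟨had' had, hbd' hbd, hcd' hcd⟩
  refine ⟨(k, shrikhandeLabel k a), (eq_of_subset_of_card_le ?_ ?_).symm⟩
  · simp [insert_subset_iff, labelClass, hb, hc, hd]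
  · rw [card_labelClass_shrikhandeLabel, hcard]

theorem hasQuarterBound_shrikhande : HasQuarterBound shrikhande := by
  intro S hS
  suffices #S ≤ 4 by simpa [ZMod.card] using Nat.mul_le_mul_left 4 this
  by_contra! h
  obtain ⟨T, hTS, hT⟩ := exists_subset_card_eq h.le
  obtain ⟨i, rfl⟩ := exists_labelClass_eq (hS.mono (coe_subset.2 hTS)) hT
  obtain ⟨u, huS, hu⟩ := exists_mem_notMem_of_card_lt_card (hT.trans_lt h)
  obtain ⟨v, hv, huv⟩ := exists_adj_of_notMem_labelClass i u hu
  exact hS huS (hTS hv) huv.ne huv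

theorem labelClass_hammingLabel_mem_quarterSets (i : Fin 4 × ZMod 4) :
    labelClass hammingLabel i ∈ quarterSets (K₄ □ K₄) := by
  refine mem_quarterSets.2 ⟨fun x hx y hy hne hadj => hne ?_, ?_⟩
  · simp only [labelClass, coe_filter, mem_univ, true_and, Set.mem_ofPred_eq] at hx hy
    have hiff := fst_eq_iff_of_hammingLabel_eq i.1 x y (hx.trans hy.symm)
    rcases SimpleGraph.boxProd_adj.1 hadj with ⟨-, h⟩ | ⟨-, h⟩
    · exact Prod.ext (hiff.2 h) h
    · exact Prod.ext h (hiff.1 h)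
  · rw [card_labelClass_hammingLabel]
    rfl

theorem card_quarterSets_shrikhande_boxProd_le {W : Type*} [Fintype W] (R : SimpleGraph W) :
    #(quarterSets (shrikhande □ R)) ≤ #(quarterSets ((K₄ □ K₄) □ R)) := by
  have hclass (S) (hS : S ∈ quarterSets shrikhande) : ∃ i, labelClass shrikhandeLabel i = S := by
    rw [mem_quarterSets, Fintype.card_prod, ZMod.card] at hS
    exact exists_labelClass_eq hS.1 (by lia)
  choose! index hindex using hclass
  refine card_quarterSets_boxProd_le hasQuarterBound_shrikhande (hasQuarterBound_top.boxProd ⊤) R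
    (Φ := fun S => labelClass hammingLabel (index S))
    (fun S _ => labelClass_hammingLabel_mem_quarterSets _) (fun S hS T hT h => ?_)
    fun S hS T hT hST => ?_
  · rw [← hindex S hS, ← hindex T hT, labelClass_hammingLabel_injective h]
  · rw [← hindex S hS, ← hindex T hT] at hST
    exact disjoint_labelClass_hammingLabel _ _ hST

end Shrikhande

section Doob

/-- A Shrikhande factor of a Doob graph. -/
def doobSuccLeft (m n : ℕ) : doob (m + 1) n ≃g (shrikhande □ doob m n) :=
  (boxProdCongr (cartesianPowerSucc shrikhande 0) .refl).trans (SimpleGraph.boxProdAssoc _ _ _)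

/-- A complete factor of a Doob graph. -/
def doobSuccRight (m n : ℕ) : doob m (n + 1) ≃g (K₄ □ doob m n) :=
  ((boxProdCongr .refl (cartesianPowerSucc K₄ 0)).trans (SimpleGraph.boxProdComm _ _)).trans
    ((SimpleGraph.boxProdAssoc _ _ _).trans (boxProdCongr .refl (SimpleGraph.boxProdComm _ _)))

/-- Without Shrikhande factors, a Doob graph is a Hamming graph. -/
def doobZeroLeft (n : ℕ) : doob 0 n ≃g cartesianPower K₄ n where
  toEquiv := Equiv.uniqueProd _ _
  map_rel_iff' := by simp [doob, cartesianPower, SimpleGraph.boxProd_adj]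

theorem hasQuarterBound_doob {m n : ℕ} (h : 2 * m + n ≠ 0) : HasQuarterBound (doob m n) := by
  rcases m with - | m
  · obtain ⟨n, rfl⟩ := Nat.exists_eq_succ_of_ne_zero (by lia : n ≠ 0)
    exact (hasQuarterBound_top.boxProd _).of_iso (doobSuccRight 0 n)
  · exact (hasQuarterBound_shrikhande.boxProd _).of_iso (doobSuccLeft m n)

theorem card_quarterSets_doob_le (m n : ℕ) :
    #(quarterSets (doob m n)) ≤ #(quarterSets (cartesianPower K₄ (2 * m + n))) := by
  induction m generalizing n with
  | zero =>
    rw [mul_zero, zero_add]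
    exact card_quarterSets_le_of_iso (doobZeroLeft n)
  | succ m ih =>
    calc #(quarterSets (doob (m + 1) n))
        ≤ #(quarterSets (shrikhande □ doob m n)) := card_quarterSets_le_of_iso (doobSuccLeft m n)
      _ ≤ #(quarterSets ((K₄ □ K₄) □ doob m n)) := card_quarterSets_shrikhande_boxProd_le _
      _ ≤ #(quarterSets (doob m (n + 2))) := card_quarterSets_le_of_iso <|
          (SimpleGraph.boxProdAssoc _ _ _).trans <|
            (boxProdCongr .refl (doobSuccRight m n).symm).trans (doobSuccRight m (n + 1)).symm
      _ ≤ #(quarterSets (cartesianPower K₄ (2 * m + (n + 2)))) := ih (n + 2)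
      _ = #(quarterSets (cartesianPower K₄ (2 * (m + 1) + n))) := by
          rw [show 2 * m + (n + 2) = 2 * (m + 1) + n by ring]

theorem isMDSCode_of_mem_quarterSets {n : ℕ} {M : Finset (Fin (n + 1) → Fin 4)}
    (hM : M ∈ quarterSets (cartesianPower K₄ (n + 1))) : IsMDSCode M := by
  intro i x
  have hmap := map_iso_mem_quarterSets (cartesianPowerSucc K₄ i) hM
  have hslice := ((mem_quarterSets_boxProd_iff hasQuarterBound_top).1 hmap).1 (i.removeNth x)
  have htrace : slice (M.map (cartesianPowerSucc K₄ i).toEquiv.toEmbedding) (i.removeNth x) =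
      lineTrace M i x := by
    ext a
    rw [mem_slice, mem_map_equiv, mem_lineTrace, ← Fin.insertNth_removeNth]
    rfl
  rw [htrace, mem_quarterSets, Fintype.card_fin] at hslice
  lia

theorem card_quarterSets_hamming_le (n : ℕ) :
    #(quarterSets (cartesianPower K₄ (n + 1))) ≤
      codeCount (univ : Finset (Fin (n + 1) → Fin 4)) :=
  card_le_card fun M hM => by simpa using isMDSCode_of_mem_quarterSets hM

end Doob

section BlockColoring

theorem sum_ne_sum_of_agree {ι M : Type*} [Fintype ι] [AddCancelCommMonoid M] {f g : ι → M} {i : ι}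
    (hi : f i ≠ g i) (h : ∀ j, j ≠ i → f j = g j) : ∑ j, f j ≠ ∑ j, g j := by
  classical
  rw [← add_sum_erase _ f (mem_univ i), ← add_sum_erase _ g (mem_univ i),
    sum_congr rfl fun j hj => h j (ne_of_mem_erase hj)]
  exact fun heq => hi (add_right_cancel heq)

/-- A partition of the vertices of `G` into blocks, indexed by `B`, on which `inner` is a proper
2-colouring, together with a 2-colouring `parity` of the blocks such that blocks joined by an edge
have different parities. Choosing one colour class in each block of a fixed parity then gives an
independent set. -/
structure BlockColoring {V : Type*} (G : SimpleGraph V) (B : Type*) where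
  block : V → B
  parity : B → ZMod 2
  inner : V → ZMod 2
  block_surjective : Function.Surjective block
  ne_of_adj : ∀ {v w}, G.Adj v w → parity (block v) ≠ parity (block w) ∨
    block v = block w ∧ inner v ≠ inner w

namespace BlockColoring

variable {V W B C : Type*} {G : SimpleGraph V} {H : SimpleGraph W}

/-- The block colouring of a product of two graphs: colours of components are added. -/
def boxProd (κ : BlockColoring G B) (μ : BlockColoring H C) : BlockColoring (G □ H) (B × C) where
  block := Prod.map κ.block μ.block
  parity b := κ.parity b.1 + μ.parity b.2
  inner v := κ.inner v.1 + μ.inner v.2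
  block_surjective := κ.block_surjective.prodMap μ.block_surjective
  ne_of_adj := by
    rintro ⟨v, w⟩ ⟨v', w'⟩ hadj
    rcases SimpleGraph.boxProd_adj.1 hadj with ⟨h, hw⟩ | ⟨h, hv⟩
    · obtain rfl : w = w' := hw
      simpa using κ.ne_of_adj h
    · obtain rfl : v = v' := hv
      simpa using μ.ne_of_adj h

/-- The block colouring of a power of a graph: colours of components are added. -/
def cartesianPower (κ : BlockColoring G B) (k : ℕ) :
    BlockColoring (DoobGraph.cartesianPower G k) (Fin k → B) where
  block x := κ.block ∘ x
  parity b := ∑ i, κ.parity (b i)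
  inner x := ∑ i, κ.inner (x i)
  block_surjective := κ.block_surjective.comp_left
  ne_of_adj := by
    rintro x y ⟨i, hadj, h⟩
    refine (κ.ne_of_adj hadj).imp (fun hi => ?_) fun ⟨hblock, hi⟩ => ⟨funext fun j => ?_, ?_⟩
    · exact sum_ne_sum_of_agree hi fun j hj => by simp [h j hj]
    · obtain rfl | hj := eq_or_ne j i
      · exact hblock
      · simp [h j hj]
    · exact sum_ne_sum_of_agree hi fun j hj => by rw [h j hj]

variable [Fintype V]

/-- The independent set that contains, in each block `b` of parity `c`, the vertices of colour
`f b`. -/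
def parityClass (κ : BlockColoring G B) (c : ZMod 2) (f : B → ZMod 2) : Finset V :=
  {v | κ.parity (κ.block v) = c ∧ κ.inner v = f (κ.block v)}

variable (κ : BlockColoring G B) (c : ZMod 2)

theorem isIndepSet_parityClass (f : B → ZMod 2) : G.IsIndepSet (κ.parityClass c f) := by
  intro v hv w hw _ hadj
  simp only [parityClass, coe_filter, mem_univ, true_and, Set.mem_ofPred_eq] at hv hw
  rcases κ.ne_of_adj hadj with hparity | ⟨hblock, hinner⟩
  · exact hparity (hv.1.trans hw.1.symm)
  · exact hinner (by rw [hv.2, hw.2, hblock])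

theorem sum_card_parityClass (f : B → ZMod 2) :
    ∑ p : ZMod 2 × ZMod 2, #(κ.parityClass p.1 fun b => f b + p.2) = Fintype.card V := by
  rw [← card_univ, card_eq_sum_card_fiberwise (f := fun v =>
    (κ.parity (κ.block v), κ.inner v - f (κ.block v))) (t := univ) (by simp)]
  simp [parityClass, Prod.ext_iff, sub_eq_iff_eq_add']

variable {κ c}

theorem parityClass_mem_quarterSets (hG : HasQuarterBound G) (f : B → ZMod 2) :
    κ.parityClass c f ∈ quarterSets G := by
  refine mem_quarterSets.2 ⟨κ.isIndepSet_parityClass c f, ?_⟩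
  have hle (p : ZMod 2 × ZMod 2) :
      4 * #(κ.parityClass p.1 fun b => f b + p.2) ≤ Fintype.card V :=
    hG _ (κ.isIndepSet_parityClass _ _)
  have hsum : ∑ p : ZMod 2 × ZMod 2, 4 * #(κ.parityClass p.1 fun b => f b + p.2) =
      ∑ _p : ZMod 2 × ZMod 2, Fintype.card V := by
    rw [← mul_sum, sum_card_parityClass]
    simp
  simpa using (sum_eq_sum_iff_of_le fun p _ => hle p).1 hsum (c, 0) (mem_univ _)

theorem eqOn_of_parityClass_eq {f g : B → ZMod 2} (h : κ.parityClass c f = κ.parityClass c g)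
    {b : B} (hb : κ.parity b = c) : f b = g b := by
  obtain ⟨v, rfl⟩ := κ.block_surjective b
  have hv : κ.inner v = f (κ.block v) ↔ κ.inner v = g (κ.block v) := by
    simpa [parityClass, hb] using Finset.ext_iff.1 h v
  have hzmod : ∀ x y z : ZMod 2, (x = y ↔ x = z) → y = z := by decide
  exact hzmod _ _ _ hv

theorem two_pow_card_le_card_quarterSets [Fintype B] (κ : BlockColoring G B)
    (hG : HasQuarterBound G) (c : ZMod 2) : 2 ^ #{b | κ.parity b = c} ≤ #(quarterSets G) := by
  classical
  rw [← card_powerset]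
  refine card_le_card_of_injOn (fun T => κ.parityClass c fun b => if b ∈ T then 1 else 0)
    (fun T _ => parityClass_mem_quarterSets hG _) fun T hT T' hT' h => ?_
  simp only [coe_powerset, Set.mem_preimage, Set.mem_powerset_iff, coe_subset, subset_iff,
    mem_filter_univ] at hT hT'
  ext b
  by_cases hb : κ.parity b = c
  · have hind := eqOn_of_parityClass_eq h hb
    by_cases hbT : b ∈ T <;> by_cases hbT' : b ∈ T' <;> simp_all
  · exact iff_of_false (fun hbT => hb (hT hbT)) fun hbT' => hb (hT' hbT')

theorem two_pow_two_pow_le_card_quarterSets [Fintype B] (κ : BlockColoring G B)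
    (hG : HasQuarterBound G) {N : ℕ} (hB : Fintype.card B = 2 ^ (N + 1)) :
    2 ^ 2 ^ N ≤ #(quarterSets G) := by
  obtain ⟨c, hc⟩ := Fintype.exists_le_card_fiber_of_mul_le_card κ.parity (n := 2 ^ N)
    (by rw [hB, ZMod.card, pow_succ'])
  exact (Nat.pow_le_pow_right two_pos hc).trans (κ.two_pow_card_le_card_quarterSets hG c)

end BlockColoring

/-- The blocks of the Shrikhande graph are the 4-cycles `ℤ₄ × {b}`. -/
def shrikhandeBlockColoring : BlockColoring shrikhande (ZMod 4) where
  block := Prod.snd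
  parity b := b.val
  inner v := v.1.val
  block_surjective := Prod.snd_surjective
  ne_of_adj {v w} := by
    revert v w
    decide +kernel

/-- The blocks of `K₄` are two disjoint edges. -/
def completeBlockColoring : BlockColoring K₄ (ZMod 2) where
  block a := a.val
  parity := id
  inner := ![0, 0, 1, 1]
  block_surjective := by decide
  ne_of_adj {a b} := by
    revert a b
    decide

/-- The block colouring of a Doob graph induced by those of its factors. -/
def doobBlockColoring (m n : ℕ) :
    BlockColoring (doob m n) ((Fin m → ZMod 4) × (Fin n → ZMod 2)) :=
  (shrikhandeBlockColoring.cartesianPower m).boxProd (completeBlockColoring.cartesianPower n)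

theorem two_pow_two_pow_le_card_quarterSets_doob {m n N : ℕ} (h : 2 * m + n = N + 1) :
    2 ^ 2 ^ N ≤ #(quarterSets (doob m n)) := by
  refine (doobBlockColoring m n).two_pow_two_pow_le_card_quarterSets
    (hasQuarterBound_doob (by lia)) ?_
  simp only [Fintype.card_prod, Fintype.card_pi_const, ZMod.card]
  rw [← h, pow_add, pow_mul]
  norm_num

end BlockColoring

section MaximumIndepSets

theorem isMaximumIndepSet_iff_mem_quarterSets {V : Type*} [Fintype V] {G : SimpleGraph V}
    (hG : HasQuarterBound G) (hne : (quarterSets G).Nonempty) {S : Finset V} :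
    G.IsMaximumIndepSet S ↔ S ∈ quarterSets G := by
  rw [mem_quarterSets]
  refine ⟨fun hS => ⟨hS.isIndepSet, ?_⟩, fun hS => ⟨hS.1, fun T hT => ?_⟩⟩
  · obtain ⟨T, hT⟩ := hne
    rw [mem_quarterSets] at hT
    have hTS := hS.maximum T hT.1
    have hbound := hG S hS.isIndepSet
    lia
  · have hbound := hG T hT
    lia

variable {m n N : ℕ}

theorem numMDS_eq_card_quarterSets (h : 2 * m + n = N + 1) :
    numMDS m n = #(quarterSets (doob m n)) := by
  have hne : (quarterSets (doob m n)).Nonempty := card_pos.1 <|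
    (Nat.two_pow_pos _).trans_le (two_pow_two_pow_le_card_quarterSets_doob h)
  rw [numMDS, ← Set.ncard_coe_finset]
  congr 1
  ext S
  exact isMaximumIndepSet_iff_mem_quarterSets (hasQuarterBound_doob (by lia)) hne

theorem two_pow_two_pow_le_numMDS (h : 2 * m + n = N + 1) : 2 ^ 2 ^ N ≤ numMDS m n :=
  (two_pow_two_pow_le_card_quarterSets_doob h).trans_eq (numMDS_eq_card_quarterSets h).symm

theorem numMDS_le_codeCount (h : 2 * m + n = N + 1) :
    numMDS m n ≤ codeCount (univ : Finset (Fin (N + 1) → Fin 4)) := by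
  rw [numMDS_eq_card_quarterSets h]
  refine (card_quarterSets_doob_le m n).trans ?_
  rw [h]
  exact card_quarterSets_hamming_le N

theorem numMDS_pos (m n : ℕ) : 0 < numMDS m n :=
  (Set.ncard_pos (Set.toFinite _)).2 SimpleGraph.maximumIndepSet_exists

/-- The number `ε(m, n)` in `numMDS m n = 2 ^ (2 ^ (2m + n - 1) * (1 + ε(m, n)))`. -/
noncomputable def mdsError (m n : ℕ) : ℝ :=
  Real.logb 2 (numMDS m n) / 2 ^ (2 * (m : ℝ) + (n : ℝ) - 1) - 1

theorem numMDS_eq_rpow (m n : ℕ) :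
    (numMDS m n : ℝ) =
      (2 : ℝ) ^ ((2 : ℝ) ^ (2 * (m : ℝ) + (n : ℝ) - 1) * (1 + mdsError m n)) := by
  have hpos : (0 : ℝ) < numMDS m n := by exact_mod_cast numMDS_pos m n
  rw [mdsError, add_sub_cancel, mul_div_cancel₀ _ (by positivity),
    Real.rpow_logb two_pos (by norm_num) hpos]

theorem numMDS_eq_rpow_of_eq (h : 2 * m + n = N + 1) :
    (numMDS m n : ℝ) = (2 : ℝ) ^ ((1 + mdsError m n) * 2 ^ N) := by
  have hN : 2 * (m : ℝ) + n - 1 = N := by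
    rw [sub_eq_iff_eq_add]
    exact_mod_cast h
  rw [numMDS_eq_rpow, hN, Real.rpow_natCast, mul_comm]

theorem mdsError_nonneg (h : 2 * m + n = N + 1) : 0 ≤ mdsError m n := by
  have hle : (2 : ℝ) ^ (1 * 2 ^ N : ℝ) ≤ 2 ^ ((1 + mdsError m n) * 2 ^ N) := by
    rw [← numMDS_eq_rpow_of_eq h, one_mul]
    exact_mod_cast two_pow_two_pow_le_numMDS h
  rw [Real.rpow_le_rpow_left_iff one_lt_two, mul_le_mul_iff_left₀ (by positivity)] at hle
  linarith

theorem mdsError_le (h : 2 * m + n = N + 1) {t : ℝ}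
    (hcount : (codeCount (univ : Finset (Fin (N + 1) → Fin 4)) : ℝ) ≤ 2 ^ ((1 + t) * 2 ^ N)) :
    mdsError m n ≤ t := by
  have hle : (2 : ℝ) ^ ((1 + mdsError m n) * 2 ^ N) ≤ 2 ^ ((1 + t) * 2 ^ N) := by
    rw [← numMDS_eq_rpow_of_eq h]
    exact le_trans (by exact_mod_cast numMDS_le_codeCount h) hcount
  rw [Real.rpow_le_rpow_left_iff one_lt_two, mul_le_mul_iff_left₀ (by positivity)] at hle
  linarith

end MaximumIndepSets

end DoobGraph

theorem theorem1 :
    ∃ ε : ℕ × ℕ → ℝ,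
      Filter.Tendsto ε (Filter.comap (fun p : ℕ × ℕ => 2 * p.1 + p.2) Filter.atTop) (nhds 0) ∧
      ∀ m n : ℕ,
        (DoobGraph.numMDS m n : ℝ) =
          (2 : ℝ) ^ ((2 : ℝ) ^ (2 * (m : ℝ) + (n : ℝ) - 1) * (1 + ε (m, n))) := by
  refine ⟨fun p => DoobGraph.mdsError p.1 p.2, Metric.tendsto_nhds.2 fun η hη => ?_,
    DoobGraph.numMDS_eq_rpow⟩
  obtain ⟨N₀, hN₀⟩ := Filter.eventually_atTop.1
    (DoobGraph.eventuallyBounded_of_pos (half_pos hη))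
  filter_upwards [Filter.tendsto_comap.eventually (Filter.eventually_ge_atTop (N₀ + 1))]
    with ⟨m, n⟩ hmn
  obtain ⟨N, hN⟩ := Nat.exists_eq_add_of_le' ((Nat.le_add_left 1 N₀).trans hmn)
  have hnonneg : 0 ≤ DoobGraph.mdsError m n := DoobGraph.mdsError_nonneg hN
  have hle : DoobGraph.mdsError m n ≤ η / 2 := DoobGraph.mdsError_le hN (hN₀ N (by lia))
  rw [Real.dist_eq, sub_zero, abs_of_nonneg hnonneg]
  exact hle.trans_lt (half_lt_self hη)
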